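/- **Digits, configurations, dynamical systems.** For $N\ge 1$ let $\Sigma_N=\{0,\dots,N-1\}$ and let $\Sigma_N^{\mathbb Z}$ carry the product topology. For $x\in\Sigma_N^{\mathbb Z}$ and $N>1$ put $\mathrm{real}_N(x)=\sum_{i\in\mathbb Z}x[-i]N^i\in[0,\infty]$. A dynamical system $(X,T)$ is a compact metrizable space $X$ with a continuous map $T:X\to X$; a conjugacy from $(X,T)$ to $(Y,S)$ is a continuous bijection $\psi:X\to Y$ with $\psi\circ T=S\circ\psi$. **Multiplication automata.** If $N=pq$, let $\mathrm{Mul}_{p,N}(x)[i]=a_0p+b_1$, where $x[i]=a_1q+a_0$ and $x[i+1]=b_1q+b_0$ with $0\le a_0,b_0<q$ and $0\le a_1,b_1<p$. These maps are bijective and commute. If $\alpha=(p_1\cdots p_k)/(q_1\cdots q_l)$ with all $p_i,q_j$ divisors of $N$ (one says that $\mathrm{Mul}_{\alpha,N}$ is defined), let $\mathrm{Mul}_{\alpha,N}$ be the composition of the maps $\mathrm{Mul}_{p_i,N}$ and $\mathrm{Mul}_{q_j,N}^{-1}$; it does not depend on the factorization. **Multiplication cubes.** Let $n=(n_1,\dots,n_d)$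 be a vector of positive integers, $N_n=\prod_i n_i$, and $m(n,v)=\prod_j n_j^{-v_j}$ for $v\in\mathbb Z^d$. For $0\ge v_1\ge v_2$ in $\mathbb Z^d$ (coordinatewise) and $a\in\mathbb N$ let $\delta_n(a;v_1,v_2)$ be the digit $a_1$ in the unique expansion $a=a_0+a_1m(n,v_1)+a_2m(n,v_2)$ with $0\le a_0<m(n,v_1)$, $0\le a_1<m(n,v_2)/m(n,v_1)$, $a_2\ge 0$. For $a\in\Sigma_{N_n}$ the cube $\mathrm{cube}_n(a)$ is the function $(v_1,v_2)\mapsto\delta_n(a;v_1,v_2)$ on the pairs $v_1\ge v_2$ in $\{-1,0\}^d$. Its value is $\mathrm{val}_n(\mathrm{cube}_n(a))=\mathrm{cube}_n(a)[\mathbf 0,-\mathbf 1]=a$. Let $X_n$ be the set of maps $f$ from $\mathbb Z^d$ to the set of these cubes such that $f[z][\mathbf 0,-\mathbf 1+e_i]=f[z+e_i][-e_i,-\mathbf 1]$ for all $z\in\mathbb Z^d$ and $1\le i\le d$. For $f\in X_n$ the integral of $f$ along a step from $z-e_i$ to $z$ is $m(n,z)\,f[z][\mathbf 0,-e_i]$,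 and its negative along the reversed step; $(p,p')f$ is the sum of these along any path of such steps from $p$ to $p'$ (the sum depends only on $p,p'$), and $\mathrm{lbl}(f,(p,p'))=(p,p')f/m(n,p')$. **Maps between configurations and tessellations.** Let $\mathrm{tess}_n:\Sigma_{N_n}^{\mathbb Z}\to X_n$ be given by $\mathrm{tess}_n(x)[z]=\mathrm{cube}_n(\mathrm{Mul}_{\alpha(z),N_n}(x)[0])$ with $\alpha(z)=\prod_i n_i^{z_i}$, and let $\mathrm{diag}_n:X_n\to\Sigma_{N_n}^{\mathbb Z}$ be given by $\mathrm{diag}_n(f)[i]=\mathrm{val}_n(f[(i,\dots,i)])$. Let $A$ be a $d\times d'$ matrix of natural numbers, each row of which has a positive entry, and let $n^A=(\prod_j n_j^{A_{ji}})_{i=1}^{d'}$. The map $\mathrm{micro}_{A,n}:X_{n^A}\to X_n$ is defined as follows: for $x\in\mathbb Z^d$ take any $z_1\ge z_2$ in $\mathbb Z^{d'}$ with $Az_1\ge x$ and $x-\mathbf 1\ge Az_2$, put $v=Az_1-x$ and $a=\mathrm{lbl}(f,(z_2,z_1))\in\mathbb N$, and let $\mathrm{micro}_{A,n}(f)[x]=\mathrm{cube}_n(\delta_n(a;-v,-v-\mathbf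 1))$ (the result does not depend on the choice of $z_1,z_2$). **The maps $\mathrm{conj}$.** For $N>1$ with prime decomposition $N=\prod_{i=1}^dp_i^{k_i}$, $p_1<\dots<p_d$, $k_i\ge 1$, let $m=(p_1,\dots,p_d)$, $M=p_1\cdots p_d$ and $A_N=\mathrm{diag}(k_1,\dots,k_d)$, so that $m^{A_N}=(p_1^{k_1},\dots,p_d^{k_d})$. Put $\mathrm{conj}_{N,M}=\mathrm{diag}_m\circ\mathrm{micro}_{A_N,m}\circ\mathrm{tess}_{m^{A_N}}:\Sigma_N^{\mathbb Z}\to\Sigma_M^{\mathbb Z}$. If $N'>1$ has the same prime divisors as $N$, put $\mathrm{conj}_{N,N'}=\mathrm{conj}_{N',M}^{-1}\circ\mathrm{conj}_{N,M}$. **Theorem.** Let $N_1,N_2>1$ be integers with the same prime divisors, and let $M$ be the product of these primes. Then $\mathrm{conj}_{N_2,M}$ is bijective (so that $\mathrm{conj}_{N_1,N_2}$ is defined), and for every real $\alpha>0$ such that $\mathrm{Mul}_{\alpha,N_1}$ and $\mathrm{Mul}_{\alpha,N_2}$ are both defined, $\mathrm{conj}_{N_1,N_2}$ is a conjugacy from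 $(\Sigma_{N_1}^{\mathbb Z},\mathrm{Mul}_{\alpha,N_1})$ to $(\Sigma_{N_2}^{\mathbb Z},\mathrm{Mul}_{\alpha,N_2})$. Moreover $\mathrm{real}_{N_2}\circ\mathrm{conj}_{N_1,N_2}=\mathrm{real}_{N_1}$ on all of $\Sigma_{N_1}^{\mathbb Z}$, as an equality in $[0,\infty]$. -/

import Mathlib

open scoped ENNReal

/-! ### Topological dynamical systems -/

/-- `(X, T)` is a topological dynamical system. -/
structure IsDynSystem {X : Type*} [TopologicalSpace X] (T : X → X) : Prop where
  compact : CompactSpace X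
  metrizable : TopologicalSpace.MetrizableSpace X
  continuous : Continuous T

/-- `(X, T)` and `(Y, S)` are dynamical systems and `ψ` is a conjugacy between them: a continuous
bijection with `ψ ∘ T = S ∘ ψ`. -/
structure IsConjugacy {X Y : Type*} [TopologicalSpace X] [TopologicalSpace Y]
    (T : X → X) (S : Y → Y) (ψ : X → Y) : Prop where
  source : IsDynSystem T
  target : IsDynSystem S
  continuous : Continuous ψ
  bijective : Function.Bijective ψ
  equivariant : ψ ∘ T = S ∘ ψ

/-! ### Configurations and multiplication automata -/

/-- Bi-infinite sequences of base-`N` digits, with the product topology. -/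
abbrev Config (N : ℕ) : Type := ℤ → Fin N

/-- Identification of configurations along an equality of bases. -/
def Config.recast {N M : ℕ} (h : N = M) (x : Config N) : Config M := fun i => Fin.cast h (x i)

/-- The number represented by a configuration, `∑ x[-i] N ^ i` over `i ∈ ℤ`, in `[0, ∞]`. -/
noncomputable def realOf (N : ℕ) (x : Config N) : ℝ≥0∞ :=
  ∑' i : ℤ, ((x (-i) : ℕ) : ℝ≥0∞) * (N : ℝ≥0∞) ^ i

theorem divisor_facts {N : ℕ} (p : N.divisors) :
    0 < (p : ℕ) ∧ 0 < N / (p : ℕ) ∧ (p : ℕ) * (N / (p : ℕ)) = N ∧ (p : ℕ) ∣ N := by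
  have h := Nat.mem_divisors.1 p.2
  have hN : 0 < N := Nat.pos_of_ne_zero h.2
  exact ⟨Nat.pos_of_dvd_of_pos h.1 hN, Nat.div_pos (Nat.le_of_dvd hN h.1)
    (Nat.pos_of_dvd_of_pos h.1 hN), Nat.mul_div_cancel' h.1, h.1⟩

theorem mulLocal_lt {N : ℕ} (p : N.divisors) (a b : Fin N) :
    (a : ℕ) % (N / p) * p + (b : ℕ) / (N / p) < N := by
  obtain ⟨hp, hq, hpq, -⟩ := divisor_facts p
  have h1 : (a : ℕ) % (N / p) + 1 ≤ N / p := Nat.mod_lt _ hq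
  have h2 : (b : ℕ) / (N / p) < p := by
    rw [Nat.div_lt_iff_lt_mul hq, hpq]; exact b.2
  calc (a : ℕ) % (N / p) * p + (b : ℕ) / (N / p) < (a : ℕ) % (N / p) * p + p := by omega
    _ = ((a : ℕ) % (N / p) + 1) * p := by ring
    _ ≤ (N / p) * p := Nat.mul_le_mul_right _ h1
    _ = N := by rw [mul_comm]; exact hpq

/-- The local rule for multiplication by `p`, where `N = p q`:
`(a₁ q + a₀, b₁ q + b₀) ↦ a₀ p + b₁`. -/
def mulLocal {N : ℕ} (p : N.divisors) (a b : Fin N) : Fin N :=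
  ⟨(a : ℕ) % (N / p) * p + (b : ℕ) / (N / p), mulLocal_lt p a b⟩

/-- The cellular automaton multiplying by a divisor `p` of `N`. -/
def mulDiv {N : ℕ} (p : N.divisors) (x : Config N) : Config N :=
  fun i => mulLocal p (x i) (x (i + 1))

/-- The complementary divisor `N / p`. -/
def coDivisor {N : ℕ} (p : N.divisors) : N.divisors :=
  ⟨N / p, Nat.mem_divisors.2
    ⟨Nat.div_dvd_of_dvd (Nat.mem_divisors.1 p.2).1, (Nat.mem_divisors.1 p.2).2⟩⟩

theorem mulDiv_coDivisor {N : ℕ} (p : N.divisors) (x : Config N) (i : ℤ) :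
    mulDiv (coDivisor p) (mulDiv p x) i = x (i + 1) := by
  obtain ⟨hp, hq, hpq, hd⟩ := divisor_facts p
  have hN : N ≠ 0 := (Nat.mem_divisors.1 p.2).2
  have hb : ∀ b : Fin N, (b : ℕ) / (N / p) < p := fun b => by
    rw [Nat.div_lt_iff_lt_mul hq, hpq]; exact b.2
  apply Fin.ext
  simp only [mulDiv, mulLocal, coDivisor, Nat.div_div_self hd hN]
  rw [Nat.mul_add_mod_of_lt (hb _), Nat.add_div_of_dvd_right (Dvd.intro_left _ rfl),
    Nat.mul_div_cancel _ hp, Nat.div_eq_of_lt (hb _), add_zero, mul_comm, Nat.div_add_mod]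

/-- The left shift. -/
def shiftPerm (N : ℕ) : Equiv.Perm (Config N) where
  toFun x := fun i => x (i + 1)
  invFun x := fun i => x (i - 1)
  left_inv x := by funext i; simp
  right_inv x := by funext i; simp

/-- The reversible cellular automaton `mulDiv p`; its inverse is `mulDiv (N / p)` followed by the
right shift. -/
def mulPerm {N : ℕ} (p : N.divisors) : Equiv.Perm (Config N) where
  toFun := mulDiv p
  invFun x := (shiftPerm N).symm (mulDiv (coDivisor p) x)
  left_inv x := by
    rw [Equiv.symm_apply_eq]
    funext i
    exact mulDiv_coDivisor p x i
  right_inv x := by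
    have hc : coDivisor (coDivisor p) = p :=
      Subtype.ext (Nat.div_div_self (Nat.mem_divisors.1 p.2).1 (Nat.mem_divisors.1 p.2).2)
    have h := fun i => mulDiv_coDivisor (coDivisor p) x i
    rw [hc] at h
    funext i
    have := h (i - 1)
    simp only [sub_add_cancel] at this
    rw [← this]
    simp only [mulDiv, shiftPerm, Equiv.coe_fn_symm_mk]
    rw [show i + 1 - 1 = i - 1 + 1 by ring]

/-- The product of a list of divisors of `N`. -/
def listProd {N : ℕ} (ps : List N.divisors) : ℕ := (ps.map (fun p => (p : ℕ))).prod

/-- The composition of the automata `mulPerm p` for `p` in a list. -/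
def listPerm {N : ℕ} (ps : List N.divisors) : Equiv.Perm (Config N) := (ps.map mulPerm).prod

/-- `α = (p₁ ⋯ pₖ) / (q₁ ⋯ qₗ)` with all `pᵢ` and `qⱼ` divisors of `N`. -/
def IsFactorization (N : ℕ) (α : ℝ) (ps qs : List N.divisors) : Prop :=
  α = (listProd ps : ℝ) / (listProd qs : ℝ)

/-- Multiplication by `α` in base `N` is defined. -/
def MulDefined (N : ℕ) (α : ℝ) : Prop := ∃ ps qs : List N.divisors, IsFactorization N α ps qs

/-- The multiplication automaton for `α` in base `N`: the composition of the automata of the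
factors in the numerator and the inverses of those in the denominator. It does not depend on the
factorization, see `mulCA_eq`. -/
noncomputable def mulCA (N : ℕ) (α : ℝ) (h : MulDefined N α) : Equiv.Perm (Config N) :=
  listPerm h.choose * (listPerm h.choose_spec.choose)⁻¹

theorem listProd_pos {N : ℕ} (ps : List N.divisors) : 0 < listProd ps := by
  induction ps with
  | nil => simp [listProd]
  | cons p ps ih =>
    have e : listProd (p :: ps) = p * listProd ps := by simp [listProd]
    rw [e]
    exact Nat.mul_pos (divisor_facts p).1 ih

theorem listProd_append {N : ℕ} (ps qs : List N.divisors) :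
    listProd (ps ++ qs) = listProd ps * listProd qs := by simp [listProd]

theorem listPerm_append {N : ℕ} (ps qs : List N.divisors) :
    listPerm (ps ++ qs) = listPerm ps * listPerm qs := by simp [listPerm]

/-- The value of the word `x[i] ⋯ x[i + k]` in base `N`. -/
def wordVal {N : ℕ} (x : Config N) (i : ℤ) : ℕ → ℕ
  | 0 => x i
  | k + 1 => wordVal x i k * N + x (i + (k + 1 : ℕ))

theorem wordVal_lt {N : ℕ} (x : Config N) (i : ℤ) (k : ℕ) : wordVal x i k < N ^ (k + 1) := by
  induction k with
  | zero => simp [wordVal]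
  | succ k ih =>
    have h2 : ((x (i + (k + 1 : ℕ)) : Fin N) : ℕ) < N := (x (i + (k + 1 : ℕ))).2
    calc wordVal x i k * N + ((x (i + (k + 1 : ℕ)) : Fin N) : ℕ) < wordVal x i k * N + N := by omega
      _ = (wordVal x i k + 1) * N := by ring
      _ ≤ N ^ (k + 1) * N := Nat.mul_le_mul_right _ ih
      _ = N ^ (k + 1 + 1) := by ring

theorem exists_carry {N : ℕ} (ps : List N.divisors) (x : Config N) :
    ∃ c : ℤ → ℕ, (∀ i, c i < listProd ps) ∧ ∀ i,
      (listPerm ps x i : ℕ) + N * c i = listProd ps * (x i : ℕ) + c (i + 1) := by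
  induction ps with
  | nil => exact ⟨fun _ => 0, by simp [listProd], by simp [listProd, listPerm]⟩
  | cons p ps ih =>
    obtain ⟨c, hc, h⟩ := ih
    obtain ⟨hp, hq, hpq, hd⟩ := divisor_facts p
    set y := listPerm ps x with hy
    refine ⟨fun i => p * c i + (y i : ℕ) / (N / p), fun i => ?_, fun i => ?_⟩
    · have h2 : (y i : ℕ) / (N / p) < p := by
        rw [Nat.div_lt_iff_lt_mul hq, hpq]; exact (y i).2
      have h3 : c i + 1 ≤ listProd ps := hc i
      calc (p : ℕ) * c i + (y i : ℕ) / (N / p) < p * (c i + 1) := by rw [mul_add]; omega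
        _ ≤ p * listProd ps := Nat.mul_le_mul_left _ h3
        _ = _ := by simp [listProd]
    · have e1 : (listPerm (p :: ps) x i : ℕ)
          = (y i : ℕ) % (N / p) * p + (y (i + 1) : ℕ) / (N / p) := by
        simp [listPerm, mulPerm, mulDiv, mulLocal, hy]
      have e2 : listProd (p :: ps) = p * listProd ps := by simp [listProd]
      have h1 := h i
      have h3 := Nat.mod_add_div (y i : ℕ) (N / p)
      rw [e1, e2]
      beta_reduce
      generalize (y i : ℕ) % (N / p) = r at *
      generalize (y i : ℕ) / (N / p) = s at *
      generalize (y (i + 1) : ℕ) / (N / p) = t at *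
      generalize N / (p : ℕ) = q at *
      have hN : (N : ℕ) * s = p * (q * s) := by rw [← mul_assoc, hpq]
      calc r * p + t + N * (p * c i + s) = p * (r + q * s + N * c i) + t := by
            rw [mul_add, hN]; ring
        _ = p * (listProd ps * (x i : ℕ) + c (i + 1)) + t := by rw [h3, h1]
        _ = _ := by ring

theorem carry_word {N : ℕ} {x y : Config N} {P : ℕ} {c : ℤ → ℕ}
    (h : ∀ i, (y i : ℕ) + N * c i = P * (x i : ℕ) + c (i + 1)) (i : ℤ) (k : ℕ) :
    wordVal y i k + N ^ (k + 1) * c i = P * wordVal x i k + c (i + (k + 1 : ℕ)) := by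
  induction k with
  | zero => simpa [wordVal] using h i
  | succ k ih =>
    have h1 := h (i + (k + 1 : ℕ))
    have e : i + (k + 1 : ℕ) + 1 = i + ((k + 1 + 1 : ℕ) : ℤ) := by push_cast; ring
    rw [e] at h1
    simp only [wordVal]
    calc wordVal y i k * N + (y (i + (k + 1 : ℕ)) : ℕ) + N ^ (k + 1 + 1) * c i
        = (wordVal y i k + N ^ (k + 1) * c i) * N + (y (i + (k + 1 : ℕ)) : ℕ) := by ring
      _ = P * wordVal x i k * N
          + ((y (i + (k + 1 : ℕ)) : ℕ) + N * c (i + (k + 1 : ℕ))) := by rw [ih]; ring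
      _ = _ := by rw [h1]; ring

theorem listProd_dvd {N : ℕ} (ps : List N.divisors) : listProd ps ∣ N ^ ps.length := by
  induction ps with
  | nil => simp [listProd]
  | cons p ps ih =>
    have : listProd (p :: ps) = p * listProd ps := by simp [listProd]
    rw [this, List.length_cons, pow_succ, mul_comm]
    exact Nat.mul_dvd_mul ih (divisor_facts p).2.2.2

theorem carry_eq {N : ℕ} {x y : Config N} {P R k : ℕ} {c : ℤ → ℕ} (hP : ∀ i, c i < P)
    (h : ∀ i, (y i : ℕ) + N * c i = P * (x i : ℕ) + c (i + 1)) (hR : N ^ (k + 1) = P * R)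
    (i : ℤ) : c i = wordVal x i k / R := by
  have hP0 : 0 < P := lt_of_le_of_lt (Nat.zero_le _) (hP 0)
  have h1 := carry_word h i k
  have h2 := wordVal_lt y i k
  have h3 := hP (i + (k + 1 : ℕ))
  rw [hR] at h1 h2
  symm
  apply Nat.div_eq_of_lt_le
  · by_contra hlt
    have h4 : wordVal x i k + 1 ≤ c i * R := by omega
    have h5 := Nat.mul_le_mul_left P h4
    have h6 : P * (c i * R) = P * R * c i := by ring
    rw [h6, mul_add, mul_one] at h5
    omega
  · have h5 : P * wordVal x i k < P * ((c i + 1) * R) := by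
      have h6 : P * ((c i + 1) * R) = P * R * c i + P * R := by ring
      omega
    exact Nat.lt_of_mul_lt_mul_left h5

theorem listPerm_congr {N : ℕ} {ps qs : List N.divisors} (h : listProd ps = listProd qs) :
    listPerm ps = listPerm qs := by
  ext x i
  obtain ⟨c, hc, h1⟩ := exists_carry ps x
  obtain ⟨c', hc', h1'⟩ := exists_carry qs x
  rw [← h] at hc' h1'
  obtain ⟨R, hR⟩ : listProd ps ∣ N ^ (ps.length + 1) :=
    (listProd_dvd ps).trans (pow_dvd_pow N (Nat.le_succ _))
  have e : ∀ i, c i = c' i := fun i => by rw [carry_eq hc h1 hR i, carry_eq hc' h1' hR i]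
  have a := h1 i
  have b := h1' i
  rw [e i, e (i + 1), ← b] at a
  exact Nat.add_right_cancel a

theorem mulCA_eq {N : ℕ} {α : ℝ} (h : MulDefined N α) {ps qs : List N.divisors}
    (hf : IsFactorization N α ps qs) : mulCA N α h = listPerm ps * (listPerm qs)⁻¹ := by
  have h0 : IsFactorization N α h.choose h.choose_spec.choose := h.choose_spec.choose_spec
  unfold mulCA
  generalize h.choose_spec.choose = qs' at *
  generalize h.choose = ps' at *
  have hq : (listProd qs : ℝ) ≠ 0 := by exact_mod_cast (listProd_pos qs).ne'
  have hq' : (listProd qs' : ℝ) ≠ 0 := by exact_mod_cast (listProd_pos qs').ne'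
  have e : listProd (ps' ++ qs) = listProd (ps ++ qs') := by
    have := h0.symm.trans hf
    rw [div_eq_div_iff hq' hq] at this
    rw [listProd_append, listProd_append]
    exact_mod_cast this
  have e1 := listPerm_congr e
  have e2 : listPerm (qs ++ qs') = listPerm (qs' ++ qs) :=
    listPerm_congr (by rw [listProd_append, listProd_append, mul_comm])
  rw [listPerm_append, listPerm_append] at e1 e2
  rw [mul_inv_eq_iff_eq_mul, mul_assoc]
  have e3 : (listPerm qs)⁻¹ * listPerm qs' = listPerm qs' * (listPerm qs)⁻¹ := by
    rw [inv_mul_eq_iff_eq_mul, ← mul_assoc, e2, mul_inv_cancel_right]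
  rw [e3, ← mul_assoc, ← e1, mul_inv_cancel_right]

theorem MulDefined.one (N : ℕ) : MulDefined N 1 := ⟨[], [], by simp [IsFactorization, listProd]⟩

theorem MulDefined.divisor {N : ℕ} (p : N.divisors) : MulDefined N (p : ℕ) :=
  ⟨[p], [], by simp [IsFactorization, listProd]⟩

theorem MulDefined.inv {N : ℕ} {α : ℝ} (h : MulDefined N α) : MulDefined N α⁻¹ := by
  obtain ⟨ps, qs, h⟩ := h
  exact ⟨qs, ps, by rw [IsFactorization] at h ⊢; rw [h, inv_div]⟩

theorem MulDefined.mul {N : ℕ} {α β : ℝ} (h : MulDefined N α) (h' : MulDefined N β) :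
    MulDefined N (α * β) := by
  obtain ⟨ps, qs, h⟩ := h
  obtain ⟨ps', qs', h'⟩ := h'
  refine ⟨ps ++ ps', qs ++ qs', ?_⟩
  rw [IsFactorization] at h h' ⊢
  rw [h, h', listProd_append, listProd_append, div_mul_div_comm]
  push_cast
  rfl

theorem MulDefined.zpow {N : ℕ} {α : ℝ} (h : MulDefined N α) (k : ℤ) : MulDefined N (α ^ k) := by
  have hn : ∀ k : ℕ, MulDefined N (α ^ k) := fun k => by
    induction k with
    | zero => simpa using MulDefined.one N
    | succ k ih => rw [pow_succ]; exact ih.mul h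
  cases k with
  | ofNat k => simpa using hn k
  | negSucc k => rw [_root_.zpow_negSucc]; exact (hn _).inv

theorem MulDefined.prod {N : ℕ} {ι : Type*} (s : Finset ι) (f : ι → ℝ)
    (h : ∀ i ∈ s, MulDefined N (f i)) : MulDefined N (∏ i ∈ s, f i) :=
  Finset.prod_induction f (MulDefined N) (fun _ _ => MulDefined.mul) (MulDefined.one N) h

theorem mulCA_divisor_mul {N : ℕ} (p : N.divisors) {α : ℝ} (h : MulDefined N α)
    (h' : MulDefined N ((p : ℕ) * α)) : mulCA N ((p : ℕ) * α) h' = mulPerm p * mulCA N α h := by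
  obtain ⟨ps, qs, hf⟩ := id h
  have hf' : IsFactorization N ((p : ℕ) * α) (p :: ps) qs := by
    rw [IsFactorization] at hf ⊢
    rw [hf, show listProd (p :: ps) = p * listProd ps by simp [listProd], ← mul_div_assoc]
    push_cast
    rfl
  rw [mulCA_eq h hf, mulCA_eq h' hf', ← mul_assoc]
  simp [listPerm]

/-! ### Multiplication cubes -/

/-- `N = n[1] ⋯ n[d]` for a prebasis `n`, a vector of positive integers. -/
def baseProd {d : ℕ} (n : Fin d → ℕ+) : ℕ := ∏ i, (n i : ℕ)

theorem baseProd_pos {d : ℕ} (n : Fin d → ℕ+) : 0 < baseProd n :=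
  Finset.prod_pos fun i _ => (n i).pos

/-- The weight `m(n, v) = ∏ n[j] ^ (-v[j])` of a vector `v`. -/
def wgt {d : ℕ} (n : Fin d → ℕ+) (v : Fin d → ℤ) : ℚ := ∏ j, ((n j : ℕ) : ℚ) ^ (-v j)

/-- The weight `m(n, v)` as a natural number, for vectors `v ≤ 0`. -/
def natWgt {d : ℕ} (n : Fin d → ℕ+) (v : Fin d → ℤ) : ℕ := ∏ j, (n j : ℕ) ^ (-v j).toNat

theorem natWgt_pos {d : ℕ} (n : Fin d → ℕ+) (v : Fin d → ℤ) : 0 < natWgt n v :=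
  Finset.prod_pos fun i _ => pow_pos (n i).pos _

theorem natWgt_eq_wgt {d : ℕ} (n : Fin d → ℕ+) {v : Fin d → ℤ} (hv : v ≤ 0) :
    (natWgt n v : ℚ) = wgt n v := by
  unfold natWgt wgt
  push_cast
  refine Finset.prod_congr rfl fun j _ => ?_
  rw [← zpow_natCast, Int.toNat_of_nonneg (neg_nonneg.2 (hv j))]

/-- For `m ∣ m'`, the digit `a₁` in the mixed base expansion `a = a₀ + a₁ m + a₂ m'` with
`0 ≤ a₀ < m` and `0 ≤ a₁ < m' / m`. -/
def midDigit (a m m' : ℕ) : ℕ := a / m % (m' / m)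

theorem midDigit_eq {a m m' a₀ a₁ a₂ : ℕ} (h : m ∣ m') (h₀ : a₀ < m) (h₁ : a₁ < m' / m)
    (ha : a = a₀ + a₁ * m + a₂ * m') : midDigit a m m' = a₁ := by
  have hm : 0 < m := lt_of_le_of_lt (Nat.zero_le _) h₀
  obtain ⟨r, rfl⟩ := h
  rw [Nat.mul_div_cancel_left _ hm] at h₁
  have e : a = a₀ + m * (a₁ + r * a₂) := by rw [ha]; ring
  rw [midDigit, e, Nat.mul_div_cancel_left _ hm, Nat.add_mul_div_left _ _ hm,
    Nat.div_eq_of_lt h₀, zero_add, Nat.add_mul_mod_self_left, Nat.mod_eq_of_lt h₁]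

/-- The middle digit of `a` in the mixed base given by the vectors `0 ≥ v₁ ≥ v₂`. -/
def vecDigit {d : ℕ} (n : Fin d → ℕ+) (a : ℕ) (v₁ v₂ : Fin d → ℤ) : ℕ :=
  midDigit a (natWgt n v₁) (natWgt n v₂)

theorem vecDigit_lt {d : ℕ} (n : Fin d → ℕ+) (a : ℕ) (v : Fin d → ℤ) (hv : 0 ≤ v) :
    vecDigit n a (-v) (-v - 1) < baseProd n := by
  have e : natWgt n (-v - 1) = natWgt n (-v) * baseProd n := by
    unfold natWgt baseProd
    rw [← Finset.prod_mul_distrib]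
    refine Finset.prod_congr rfl fun j _ => ?_
    rw [← pow_succ]
    congr 1
    have := hv j
    simp only [Pi.zero_apply] at this
    simp only [Pi.sub_apply, Pi.neg_apply, Pi.one_apply]
    omega
  rw [vecDigit, midDigit, e, Nat.mul_div_cancel_left _ (natWgt_pos n _)]
  exact Nat.mod_lt _ (baseProd_pos n)

/-- The faces of the cube `[-1, 0]^d`: pairs `v₁ ≥ v₂` of vectors in `{-1, 0}^d`, standing for the
smallest face that contains both. -/
def Face (d : ℕ) : Type :=
  {v : (Fin d → ℤ) × (Fin d → ℤ) //
    (∀ i, v.1 i = -1 ∨ v.1 i = 0) ∧ (∀ i, v.2 i = -1 ∨ v.2 i = 0) ∧ v.2 ≤ v.1}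

/-- The standard basis vector `e_i`. -/
def stdVec {d : ℕ} (i : Fin d) : Fin d → ℤ := Pi.single i 1

/-- The bottom face orthogonal to `e_i`, spanned by `-e_i` and `-1`. -/
def Face.bot {d : ℕ} (i : Fin d) : Face d :=
  ⟨(-stdVec i, -1), by
    refine ⟨fun j => ?_, fun j => Or.inl rfl, fun j => ?_⟩ <;>
      rcases eq_or_ne j i with rfl | h <;> simp [stdVec, *]⟩

/-- The top face orthogonal to `e_i`, spanned by `0` and `-1 + e_i`. -/
def Face.top {d : ℕ} (i : Fin d) : Face d :=
  ⟨(0, -1 + stdVec i), by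
    refine ⟨fun j => Or.inr rfl, fun j => ?_, fun j => ?_⟩ <;>
      rcases eq_or_ne j i with rfl | h <;> simp [stdVec, *]⟩

/-- The edge spanned by `0` and `-e_i`. -/
def Face.edge {d : ℕ} (i : Fin d) : Face d :=
  ⟨(0, -stdVec i), by
    refine ⟨fun j => Or.inr rfl, fun j => ?_, fun j => ?_⟩ <;>
      rcases eq_or_ne j i with rfl | h <;> simp [stdVec, *]⟩

/-- The whole cube, spanned by `0` and `-1`. -/
def Face.full (d : ℕ) : Face d :=
  ⟨(0, -1), fun _ => Or.inr rfl, fun _ => Or.inl rfl, fun _ => by simp⟩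

/-- The labeling of the faces by the multiplication cube with value `a`. -/
def cubeFun {d : ℕ} (n : Fin d → ℕ+) (a : Fin (baseProd n)) : Face d → Fin (baseProd n) :=
  fun s => ⟨vecDigit n a s.1.1 s.1.2,
    lt_of_le_of_lt ((Nat.mod_le _ _).trans (Nat.div_le_self _ _)) a.2⟩

/-- The set `T_n` of base-`n` multiplication cubes. -/
def Cube {d : ℕ} (n : Fin d → ℕ+) : Type := Set.range (cubeFun n)

/-- The multiplication cube with value `a`. -/
def cube {d : ℕ} (n : Fin d → ℕ+) (a : Fin (baseProd n)) : Cube n := ⟨cubeFun n a, a, rfl⟩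

/-- The value of a multiplication cube, the label of its full face. -/
def Cube.val {d : ℕ} {n : Fin d → ℕ+} (t : Cube n) : Fin (baseProd n) := t.1 (Face.full d)

theorem Cube.val_cube {d : ℕ} (n : Fin d → ℕ+) (a : Fin (baseProd n)) : (cube n a).val = a := by
  apply Fin.ext
  have e0 : natWgt n 0 = 1 := by simp [natWgt]
  have e1 : natWgt n (-1) = baseProd n := by simp [natWgt, baseProd]
  simp only [Cube.val, cube, cubeFun, Face.full, vecDigit, midDigit, e0, e1, Nat.div_one]
  exact Nat.mod_eq_of_lt a.2

/-- The set `X_n` of valid tessellations by multiplication cubes: the labels of adjacent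
hyperfaces of neighbouring cubes match. -/
def tessellations {d : ℕ} (n : Fin d → ℕ+) : Set ((Fin d → ℤ) → Cube n) :=
  {f | ∀ z i, (f z).1 (Face.top i) = (f (z + stdVec i)).1 (Face.bot i)}

/-! ### Configurations and tessellations -/

/-- `n[i]` as a divisor of `N`. -/
def coordDivisor {d : ℕ} (n : Fin d → ℕ+) (i : Fin d) : (baseProd n).divisors :=
  ⟨n i, Nat.mem_divisors.2
    ⟨Finset.dvd_prod_of_mem (fun i => (n i : ℕ)) (Finset.mem_univ i), (baseProd_pos n).ne'⟩⟩

/-- `α(z, n) = ∏ n[i] ^ z[i]`. -/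
noncomputable def vecScale {d : ℕ} (n : Fin d → ℕ+) (z : Fin d → ℤ) : ℝ :=
  ∏ i, ((n i : ℕ) : ℝ) ^ z i

theorem mulDefined_vecScale {d : ℕ} (n : Fin d → ℕ+) (z : Fin d → ℤ) :
    MulDefined (baseProd n) (vecScale n z) :=
  MulDefined.prod _ _ fun i _ => (MulDefined.divisor (coordDivisor n i)).zpow (z i)

/-- The cube at `z` in the tessellation of a configuration `x`: its value is the digit at `0` of
`x` multiplied by `α(z, n)`. -/
noncomputable def tessFun {d : ℕ} (n : Fin d → ℕ+) (x : Config (baseProd n)) :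
    (Fin d → ℤ) → Cube n :=
  fun z => cube n (mulCA (baseProd n) (vecScale n z) (mulDefined_vecScale n z) x 0)

theorem vecScale_add {d : ℕ} (n : Fin d → ℕ+) (z : Fin d → ℤ) (i : Fin d) :
    vecScale n (z + stdVec i) = ((coordDivisor n i : ℕ) : ℝ) * vecScale n z := by
  have h0 : ∀ j, ((n j : ℕ) : ℝ) ≠ 0 := fun j => by exact_mod_cast (n j).ne_zero
  have e : ∀ j, ((n j : ℕ) : ℝ) ^ (z + stdVec i) j
      = ((n j : ℕ) : ℝ) ^ z j * (if j = i then ((n i : ℕ) : ℝ) else 1) := fun j => by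
    rcases eq_or_ne j i with rfl | h
    · simp [stdVec, zpow_add_one₀ (h0 _)]
    · simp [stdVec, h]
  unfold vecScale
  simp only [e, Finset.prod_mul_distrib, Finset.prod_ite_eq', Finset.mem_univ, if_true]
  rw [mul_comm]
  rfl

theorem natWgt_face {d : ℕ} (n : Fin d → ℕ+) (i : Fin d) :
    natWgt n 0 = 1 ∧ natWgt n (-1) = baseProd n ∧ natWgt n (-stdVec i) = n i ∧
      natWgt n (-1 + stdVec i) = baseProd n / n i := by
  have h1 : natWgt n (-stdVec i) = n i := by
    have e : ∀ j, (n j : ℕ) ^ (-(-stdVec i) j).toNat = if j = i then (n i : ℕ) else 1 := fun j => by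
      rcases eq_or_ne j i with rfl | h
      · simp [stdVec]
      · simp [stdVec, h]
    simp only [natWgt, e, Finset.prod_ite_eq', Finset.mem_univ, if_true]
  refine ⟨by simp [natWgt], by simp [natWgt, baseProd], h1, ?_⟩
  symm
  apply Nat.div_eq_of_eq_mul_left (n i).pos
  rw [← h1]
  unfold natWgt baseProd
  rw [← Finset.prod_mul_distrib]
  refine Finset.prod_congr rfl fun j _ => ?_
  rcases eq_or_ne j i with rfl | h
  · simp [stdVec]
  · simp [stdVec, h]

theorem tessFun_mem {d : ℕ} (n : Fin d → ℕ+) (x : Config (baseProd n)) :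
    tessFun n x ∈ tessellations n := by
  intro z i
  obtain ⟨e0, e1, e2, e3⟩ := natWgt_face n i
  set p := coordDivisor n i with hp
  have hpi : (p : ℕ) = n i := rfl
  obtain ⟨hp0, hq, hpq, hd⟩ := divisor_facts p
  have key : mulCA (baseProd n) (vecScale n (z + stdVec i)) (mulDefined_vecScale n _)
      = mulPerm p * mulCA (baseProd n) (vecScale n z) (mulDefined_vecScale n z) := by
    have h' : MulDefined (baseProd n) ((p : ℕ) * vecScale n z) := by
      rw [← vecScale_add]; exact mulDefined_vecScale n _
    rw [← mulCA_divisor_mul p _ h']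
    congr 1
    exact vecScale_add n z i
  apply Fin.ext
  simp only [tessFun, cube, cubeFun, Face.top, Face.bot, vecDigit, midDigit, key, e0, e1, e2, e3,
    Nat.div_one, Equiv.Perm.mul_apply]
  generalize mulCA (baseProd n) (vecScale n z) (mulDefined_vecScale n z) x = y
  rw [← hpi]
  have hb : (y (0 + 1) : ℕ) / (baseProd n / p) < p := by
    rw [Nat.div_lt_iff_lt_mul hq, hpq]; exact (y (0 + 1)).2
  simp only [mulPerm, Equiv.coe_fn_mk, mulDiv, mulLocal]
  rw [Nat.add_div_of_dvd_right (Dvd.intro_left _ rfl), Nat.mul_div_cancel _ hp0,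
    Nat.div_eq_of_lt hb, add_zero, Nat.mod_mod]

/-- The tessellation of a configuration. -/
noncomputable def tess {d : ℕ} (n : Fin d → ℕ+) (x : Config (baseProd n)) : tessellations n :=
  ⟨tessFun n x, tessFun_mem n x⟩

/-- The configuration on the main diagonal. -/
def diag {d : ℕ} (n : Fin d → ℕ+) (f : (Fin d → ℤ) → Cube n) : Config (baseProd n) :=
  fun i => (f fun _ => i).val

/-! ### Path integrals and labels -/

/-- Paths in the grid `ℤ^d` from `p` to another point, by steps `± e_i`. -/
inductive GridPath {d : ℕ} (p : Fin d → ℤ) : (Fin d → ℤ) → Type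
  | nil : GridPath p p
  | fwd {q : Fin d → ℤ} (P : GridPath p q) (i : Fin d) : GridPath p (q + stdVec i)
  | bwd {q : Fin d → ℤ} (P : GridPath p q) (i : Fin d) : GridPath p (q - stdVec i)

/-- The integral of a single edge `(z - e_i, z)` in the forward direction: its label multiplied by
the weight of its end point. -/
def edgeIntegral {d : ℕ} {n : Fin d → ℕ+} (f : tessellations n) (i : Fin d) (z : Fin d → ℤ) : ℚ :=
  wgt n z * (((f.1 z).1 (Face.edge i) : ℕ) : ℚ)

/-- The path integral of a tessellation. -/
def GridPath.integral {d : ℕ} {n : Fin d → ℕ+} (f : tessellations n) {p : Fin d → ℤ} :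
    {q : Fin d → ℤ} → GridPath p q → ℚ
  | _, .nil => 0
  | _, .fwd (q := q) P i => P.integral f + edgeIntegral f i (q + stdVec i)
  | _, .bwd (q := q) P i => P.integral f - edgeIntegral f i q

theorem GridPath.exists_path {d : ℕ} (p q : Fin d → ℤ) : Nonempty (GridPath p q) := by
  have h1 : ∀ (q : Fin d → ℤ) (i : Fin d) (k : ℤ), Nonempty (GridPath p q) →
      Nonempty (GridPath p (q + k • stdVec i)) := by
    intro q i k hq
    induction k with
    | zero => simpa using hq
    | succ k ih =>
      obtain ⟨P⟩ := ih
      have e : q + ((k : ℤ) + 1) • stdVec i = q + (k : ℤ) • stdVec i + stdVec i := by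
        rw [add_smul, one_smul, add_assoc]
      rw [e]
      exact ⟨P.fwd i⟩
    | pred k ih =>
      obtain ⟨P⟩ := ih
      have e : q + (-(k : ℤ) - 1) • stdVec i = q + (-(k : ℤ)) • stdVec i - stdVec i := by
        rw [sub_smul, one_smul, add_sub_assoc]
      rw [e]
      exact ⟨P.bwd i⟩
  have h2 : ∀ s : Finset (Fin d),
      Nonempty (GridPath p (p + ∑ i ∈ s, (q i - p i) • stdVec i)) := by
    intro s
    induction s using Finset.induction_on with
    | empty => simpa using ⟨GridPath.nil⟩
    | insert i s hi ih =>
      rw [Finset.sum_insert hi, add_comm ((q i - p i) • stdVec i), ← add_assoc]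
      exact h1 _ i _ ih
  have e : p + ∑ i, (q i - p i) • stdVec i = q := by
    funext j
    simp [stdVec, Finset.sum_apply, Pi.single_apply]
  rw [← e]
  exact h2 _

/-- The path integral `(p, q) f` over a path from `p` to `q`; for valid tessellations it is the same
for all such paths. -/
noncomputable def integralFrom {d : ℕ} {n : Fin d → ℕ+} (f : tessellations n)
    (p q : Fin d → ℤ) : ℚ := (Classical.choice (GridPath.exists_path p q)).integral f

/-- The label `lbl(f, (p, q))` of the directed pair `(p, q)`. -/
noncomputable def label {d : ℕ} {n : Fin d → ℕ+} (f : tessellations n) (p q : Fin d → ℤ) : ℚ :=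
  integralFrom f p q / wgt n q

/-! ### Microtiles -/

/-- The prebasis `n ^ A`, with `n ^ A [i] = ∏ n[j] ^ A[j, i]`. -/
def powMat {d d' : ℕ} (n : Fin d → ℕ+) (A : Matrix (Fin d) (Fin d') ℕ) : Fin d' → ℕ+ :=
  fun i => ∏ j, n j ^ A j i

/-- The vector `A z`. -/
def matVec {d d' : ℕ} (A : Matrix (Fin d) (Fin d') ℕ) (z : Fin d' → ℤ) : Fin d → ℤ :=
  (A.map (Nat.cast : ℕ → ℤ)).mulVec z

/-- The points `z = (z₁, z₂)` may be used to find the microtile at `x`. -/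
def IsBracket {d d' : ℕ} (A : Matrix (Fin d) (Fin d') ℕ) (x : Fin d → ℤ)
    (z : (Fin d' → ℤ) × (Fin d' → ℤ)) : Prop :=
  x ≤ matVec A z.1 ∧ z.2 ≤ z.1 ∧ matVec A z.2 ≤ x - 1

theorem exists_bracket {d d' : ℕ} (A : Matrix (Fin d) (Fin d') ℕ) (hA : ∀ i, ∃ j, 0 < A i j)
    (x : Fin d → ℤ) : ∃ z, IsBracket A x z := by
  set K : ℤ := ∑ i, |x i| + 1 with hK
  have hK0 : 0 ≤ K := by positivity
  have hx : ∀ i, |x i| + 1 ≤ K := fun i => by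
    have := Finset.single_le_sum (f := fun i => |x i|) (fun j _ => abs_nonneg _)
      (Finset.mem_univ i)
    omega
  have hs : ∀ i, 1 ≤ ∑ j, (A i j : ℤ) := fun i => by
    obtain ⟨j, hj⟩ := hA i
    have h1 := Finset.single_le_sum (f := fun j => (A i j : ℤ)) (fun j _ => by positivity)
      (Finset.mem_univ j)
    omega
  have e : ∀ (c : ℤ) (i : Fin d), matVec A (fun _ => c) i = (∑ j, (A i j : ℤ)) * c := fun c i => by
    simp [matVec, Matrix.mulVec, dotProduct, Finset.sum_mul]
  have hb : ∀ i, K ≤ (∑ j, (A i j : ℤ)) * K := fun i => le_mul_of_one_le_left hK0 (hs i)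
  refine ⟨(fun _ => K, fun _ => -K), fun i => ?_, fun i => ?_, fun i => ?_⟩
  · rw [e]
    have h1 := hb i
    have h2 := hx i
    have h3 := le_abs_self (x i)
    linarith
  · change -K ≤ K
    omega
  · rw [e, mul_neg]
    have h1 := hb i
    have h2 := hx i
    have h3 := neg_abs_le (x i)
    change _ ≤ x i - 1
    omega

/-- The microtile map `X_{n ^ A} → X_n` for a matrix `A` all of whose rows contain a positive
integer. To find the cube at `x`, take any `z₁ ≥ z₂` with `A z₁ ≥ x` and `x - 1 ≥ A z₂`, let
`x = A z₁ - v`, and let `a` be the label of `(z₂, z₁)`, a natural number; the value of the cube is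
the digit of `a` at `(-v, -v - 1)`. The result is again a valid tessellation, but this is not
needed to read off its diagonal. -/
noncomputable def micro {d d' : ℕ} (n : Fin d → ℕ+) (A : Matrix (Fin d) (Fin d') ℕ)
    (hA : ∀ i, ∃ j, 0 < A i j) (f : tessellations (powMat n A)) : (Fin d → ℤ) → Cube n :=
  fun x =>
    let z := (exists_bracket A hA x).choose
    let v := matVec A z.1 - x
    let a : ℕ := ⌊label f z.2 z.1⌋₊
    cube n ⟨vecDigit n a (-v) (-v - 1),
      vecDigit_lt n a v (sub_nonneg.2 (exists_bracket A hA x).choose_spec.1)⟩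

/-! ### The conjugacy -/

/-- The increasing sequence of the prime divisors of `N`. -/
def primeVec (N : ℕ) : Fin N.primeFactors.card → ℕ+ := fun i =>
  ⟨N.primeFactors.orderEmbOfFin rfl i,
    (Nat.prime_of_mem_primeFactors (N.primeFactors.orderEmbOfFin_mem rfl i)).pos⟩

/-- The diagonal matrix of the exponents in the prime decomposition of `N`. -/
def expMat (N : ℕ) : Matrix (Fin N.primeFactors.card) (Fin N.primeFactors.card) ℕ :=
  Matrix.diagonal fun i => N.factorization (primeVec N i)

/-- The product of the prime divisors of `N`. -/
def primeProd (N : ℕ) : ℕ := ∏ p ∈ N.primeFactors, p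

theorem prod_primeVec (N : ℕ) (g : ℕ → ℕ) :
    ∏ i, g (primeVec N i) = ∏ p ∈ N.primeFactors, g p := by
  rw [← Finset.prod_coe_sort N.primeFactors g]
  exact Fintype.prod_equiv (N.primeFactors.orderIsoOfFin rfl).toEquiv _ _ fun i => rfl

theorem baseProd_primeVec (N : ℕ) : baseProd (primeVec N) = primeProd N :=
  prod_primeVec N fun p => p

theorem powMat_primeVec (N : ℕ) (i : Fin N.primeFactors.card) :
    powMat (primeVec N) (expMat N) i = primeVec N i ^ N.factorization (primeVec N i) := by
  unfold powMat
  rw [Finset.prod_eq_single i]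
  · simp [expMat]
  · intro j _ hj
    simp [expMat, hj]
  · simp

theorem baseProd_powMat {N : ℕ} (hN : 1 < N) : N = baseProd (powMat (primeVec N) (expMat N)) := by
  have h : baseProd (powMat (primeVec N) (expMat N))
      = ∏ i, (primeVec N i : ℕ) ^ N.factorization (primeVec N i) :=
    Finset.prod_congr rfl fun i _ => by rw [powMat_primeVec]; rfl
  rw [h, prod_primeVec N fun p => p ^ N.factorization p]
  exact (Nat.prod_factorization_pow_eq_self (by omega)).symm

theorem expMat_row (N : ℕ) (i : Fin N.primeFactors.card) : ∃ j, 0 < expMat N i j := by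
  refine ⟨i, ?_⟩
  have hm : (primeVec N i : ℕ) ∈ N.primeFactors := N.primeFactors.orderEmbOfFin_mem rfl i
  simp only [expMat, Matrix.diagonal_apply_eq]
  exact (Nat.prime_of_mem_primeFactors hm).factorization_pos_of_dvd
    (Nat.mem_primeFactors.1 hm).2.2 (Nat.dvd_of_mem_primeFactors hm)

/-- The map `conj_{N, M}` from base `N` to base `M`, the product of the prime divisors of `N`:
`diag_m ∘ micro_{A, m} ∘ tess_{m ^ A}` with `m` the vector of these primes and `A` the diagonal
matrix of their exponents in `N`. -/
noncomputable def conjToPrimes (N : ℕ) (hN : 1 < N) (x : Config N) : Config (primeProd N) :=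
  (diag (primeVec N) (micro (primeVec N) (expMat N) (expMat_row N)
    (tess (powMat (primeVec N) (expMat N)) (x.recast (baseProd_powMat hN))))).recast
      (baseProd_primeVec N)

/-- The map `conj_{N, N'} = conj_{N', M}⁻¹ ∘ conj_{N, M}` for bases with the same prime
divisors. -/
noncomputable def conjMap (N N' : ℕ) (hN : 1 < N) (hN' : 1 < N')
    (h : N.primeFactors = N'.primeFactors) (x : Config N) : Config N' :=
  haveI : Nonempty (Config N') := ⟨fun _ => ⟨0, by omega⟩⟩
  Function.invFun (conjToPrimes N' hN')
    ((conjToPrimes N hN x).recast (by rw [primeProd, primeProd, h]))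

/-! A configuration `x` in base `N` is a formal number ξ = ∑ x[-i] N^i, possibly infinite. Let `α`
be a quotient of numbers composed of primes of `N`, and `Q` such a number. Although ξ may diverge,
the residue ⌊α ξ⌋ mod `Q` makes sense: computed from the truncations of ξ to `x[-n] ⋯ x[n]`, it is
eventually constant (`floorSeq_stable`). The floors are those of the truncations, so expansions such
as 0.999… and 1 stay distinct.

The resulting function D = `digitAt x` of (α, Q) satisfies two compatibilities (`IsDigitFamily`)
that mention only the primes of `N`. By `IsDigitFamily.ext` it is determined by its values at (N^i,
N), which are the digits of `x`. So D is a base-free description of `x`, and every map in the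
theorem is simple in terms of it: - `Mul_β` replaces D(α, Q) by D(β α, Q) (`digitAt_mulCA`). - In
the tessellation of `x`, path integrals are differences of the potential wgt(z) ⌊ξ / wgt(z)⌋, so
labels are values of D, and the microtile at `w` has value D(1 / wgt(w), ∏ n_i) (`micro_tess_val`).
- On the diagonal this reads D(M^i, M), so `conj_{N,M}` rewrites D in base `M` and leaves D itself
unchanged (`digitAt_conjToPrimes`).

Bijectivity, equivariance and continuity follow. The represented number is the supremum of D(N^n,
N^(2n+1)) / N^n, hence is also a function of D. -/

open Filter

/-! ### Smooth numbers and scales -/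

/-- All prime factors of `Q` divide `N`. -/
def IsSmooth (N Q : ℕ) : Prop := ∃ k, Q ∣ N ^ k

theorem IsSmooth.mul {N Q R : ℕ} (hQ : IsSmooth N Q) (hR : IsSmooth N R) :
    IsSmooth N (Q * R) := by
  obtain ⟨k, hk⟩ := hQ
  obtain ⟨l, hl⟩ := hR
  exact ⟨k + l, by rw [pow_add]; exact Nat.mul_dvd_mul hk hl⟩

theorem IsSmooth.pow {N Q : ℕ} (hQ : IsSmooth N Q) (j : ℕ) : IsSmooth N (Q ^ j) := by
  obtain ⟨k, hk⟩ := hQ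
  exact ⟨k * j, by rw [pow_mul]; exact pow_dvd_pow_of_dvd hk j⟩

theorem IsSmooth.of_dvd {N Q R : ℕ} (hQ : IsSmooth N Q) (h : R ∣ Q) : IsSmooth N R :=
  hQ.imp fun _ hk => h.trans hk

theorem IsSmooth.one (N : ℕ) : IsSmooth N 1 := ⟨0, one_dvd _⟩

theorem IsSmooth.self (N : ℕ) : IsSmooth N N := ⟨1, by simp⟩

theorem IsSmooth.pos {N Q : ℕ} (hN : 0 < N) (hQ : IsSmooth N Q) : 0 < Q := by
  obtain ⟨k, hk⟩ := hQ
  exact Nat.pos_of_dvd_of_pos hk (pow_pos hN k)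

theorem IsSmooth.trans {N M Q : ℕ} (hN : IsSmooth M N) (hQ : IsSmooth N Q) : IsSmooth M Q := by
  obtain ⟨k, hk⟩ := hQ
  exact (hN.pow k).of_dvd hk

theorem IsSmooth.prod {N : ℕ} {ι : Type*} (s : Finset ι) (f : ι → ℕ)
    (h : ∀ i ∈ s, IsSmooth N (f i)) : IsSmooth N (∏ i ∈ s, f i) :=
  Finset.prod_induction f (IsSmooth N) (fun _ _ => IsSmooth.mul) (IsSmooth.one N) h

theorem isSmooth_of_primeFactors_subset {N M : ℕ} (hN : N ≠ 0)
    (h : N.primeFactors ⊆ M.primeFactors) : IsSmooth M N := by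
  rw [← Nat.prod_factorization_pow_eq_self hN]
  exact IsSmooth.prod _ _ fun p hp =>
    ((IsSmooth.self M).of_dvd (Nat.dvd_of_mem_primeFactors (h hp))).pow _

/-- `α` is a quotient of two numbers all of whose prime factors divide `N`. -/
def IsScale (N : ℕ) (α : ℚ) : Prop :=
  ∃ a b : ℕ, IsSmooth N a ∧ IsSmooth N b ∧ α = a / b

theorem IsSmooth.isScale {N Q : ℕ} (hQ : IsSmooth N Q) : IsScale N Q :=
  ⟨Q, 1, hQ, IsSmooth.one N, by simp⟩

theorem IsScale.inv {N : ℕ} {α : ℚ} (h : IsScale N α) : IsScale N α⁻¹ := by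
  obtain ⟨a, b, ha, hb, rfl⟩ := h
  exact ⟨b, a, hb, ha, by rw [inv_div]⟩

theorem IsScale.mul {N : ℕ} {α β : ℚ} (h : IsScale N α) (h' : IsScale N β) :
    IsScale N (α * β) := by
  obtain ⟨a, b, ha, hb, rfl⟩ := h
  obtain ⟨a', b', ha', hb', rfl⟩ := h'
  exact ⟨a * a', b * b', ha.mul ha', hb.mul hb', by push_cast; rw [div_mul_div_comm]⟩

theorem IsScale.div {N : ℕ} {α β : ℚ} (h : IsScale N α) (h' : IsScale N β) :
    IsScale N (α / β) := by
  rw [div_eq_mul_inv]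
  exact h.mul h'.inv

theorem IsScale.prod {N : ℕ} {ι : Type*} (s : Finset ι) (f : ι → ℚ)
    (h : ∀ i ∈ s, IsScale N (f i)) : IsScale N (∏ i ∈ s, f i) :=
  Finset.prod_induction f (IsScale N) (fun _ _ => IsScale.mul)
    (by simpa using (IsSmooth.one N).isScale) h

theorem IsSmooth.isScale_zpow {N Q : ℕ} (hQ : IsSmooth N Q) (k : ℤ) :
    IsScale N ((Q : ℚ) ^ k) := by
  cases k with
  | ofNat k => simpa using (hQ.pow k).isScale
  | negSucc k => rw [_root_.zpow_negSucc]; simpa using (hQ.pow (k + 1)).isScale.inv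

theorem IsScale.trans {N M : ℕ} {α : ℚ} (hN : IsSmooth M N) (h : IsScale N α) : IsScale M α := by
  obtain ⟨a, b, ha, hb, e⟩ := h
  exact ⟨a, b, hN.trans ha, hN.trans hb, e⟩

/-! ### Digits of a configuration at arbitrary scales -/

theorem wordVal_succ_left {N : ℕ} (x : Config N) (i : ℤ) (k : ℕ) :
    wordVal x i (k + 1) = (x i : ℕ) * N ^ (k + 1) + wordVal x (i + 1) k := by
  induction k with
  | zero => simp [wordVal]
  | succ k ih =>
    rw [wordVal, ih, wordVal,
      show i + ((k + 1 + 1 : ℕ) : ℤ) = i + 1 + (k + 1 : ℕ) by push_cast; ring]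
    ring

theorem wordVal_mod {N : ℕ} (x : Config N) (i : ℤ) (k : ℕ) :
    wordVal x i k % N = x (i + k) := by
  cases k with
  | zero => simp [wordVal, Nat.mod_eq_of_lt (x i).2]
  | succ k => rw [wordVal, Nat.mul_add_mod_of_lt (x _).2]

theorem wordVal_add_div {N : ℕ} (hN : 0 < N) (x : Config N) (i : ℤ) (k l : ℕ) :
    wordVal x i (k + l) / N ^ l = wordVal x i k := by
  induction l with
  | zero => simp
  | succ l ih =>
    rw [pow_succ', ← Nat.div_div_eq_div_mul, ← add_assoc, wordVal, mul_comm,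
      Nat.mul_add_div hN, Nat.div_eq_of_lt (x _).2, add_zero, ih]

/-- The value of the central word `x[-n] ⋯ x[n]`. -/
def centralVal {N : ℕ} (x : Config N) (n : ℕ) : ℕ := wordVal x (-n) (2 * n)

theorem centralVal_succ {N : ℕ} (x : Config N) (n : ℕ) :
    centralVal x (n + 1) = ((x (-(n + 1 : ℕ)) : ℕ) * N ^ (2 * n + 1) + centralVal x n) * N
      + x (n + 1 : ℕ) := by
  rw [centralVal, show 2 * (n + 1) = 2 * n + 1 + 1 by ring, wordVal, wordVal_succ_left, centralVal]
  congr 4 <;> push_cast <;> ring_nf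

/-- The integral part of `α` times the number represented by `x[-n] ⋯ x[n]`. -/
def floorSeq {N : ℕ} (x : Config N) (α : ℚ) (n : ℕ) : ℕ :=
  ⌊α * ((centralVal x n : ℚ) / (N : ℚ) ^ n)⌋₊

theorem floorSeq_eq {N : ℕ} (hN : 0 < N) (x : Config N) {α : ℚ} {n R : ℕ} (hR : 0 < R)
    (h : α * R = (N : ℚ) ^ n) : floorSeq x α n = centralVal x n / R := by
  have hR' : (R : ℚ) ≠ 0 := by positivity
  have hN' : (N : ℚ) ^ n ≠ 0 := by positivity
  rw [← Nat.floor_div_eq_div (K := ℚ), floorSeq]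
  congr 1
  rw [← h]
  have : α ≠ 0 := by rintro rfl; simp at h; exact hN' h.symm
  field_simp

theorem floorSeq_div {N : ℕ} (x : Config N) (α : ℚ) (R n : ℕ) :
    floorSeq x (α / R) n = floorSeq x α n / R := by
  rw [floorSeq, floorSeq, ← Nat.floor_div_natCast]
  congr 1
  ring

/-- For large `n` there is a natural number `R` with α R = N^n, so the floors at `n` and `n + 1` are
quotients of the central values by `R` and `N R`. The new digit on the right disappears on division
by `N`. The new digit on the left adds a multiple of N^(2n+1), hence of R Q, which changes the
quotient by a multiple of `Q`. The bound `n₀` does not depend on `x`; this uniformity later gives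
continuity. -/
theorem floorSeq_stable {N : ℕ} (hN : 0 < N) {α : ℚ} (hα : IsScale N α) {Q : ℕ}
    (hQ : IsSmooth N Q) :
    ∃ n₀, ∀ (x : Config N) (n : ℕ), n₀ ≤ n → floorSeq x α n % Q = floorSeq x α n₀ % Q := by
  obtain ⟨a, b, ha, hb, rfl⟩ := hα
  have ha0 := ha.pos hN
  have hb0 := hb.pos hN
  obtain ⟨k, a', hk⟩ := ha
  obtain ⟨l, hl⟩ := hb
  obtain ⟨j, hj⟩ := hQ
  have ha'0 : 0 < a' := Nat.pos_of_ne_zero (by rintro rfl; simp at hk; omega)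
  -- `n ≥ k` makes `R = b a' N^(n-k)` meaningful; `l + j ≤ n + 1` gives R Q ∣ N^(2n+1).
  refine ⟨k + l + j, fun x n hn => ?_⟩
  induction n, hn using Nat.le_induction with
  | base => rfl
  | succ n hn ih =>
    rw [← ih]
    obtain ⟨R, hR⟩ : ∃ R, R = b * a' * N ^ (n - k) := ⟨_, rfl⟩
    have hR0 : 0 < R := by rw [hR]; positivity
    have hRn : (a : ℚ) / b * R = (N : ℚ) ^ n := by
      have e : a * a' * N ^ (n - k) = N ^ n := by
        rw [← hk, ← pow_add]; congr 1; omega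
      have hb' : (b : ℚ) ≠ 0 := by positivity
      rw [hR, ← Nat.cast_pow, ← e]
      push_cast
      field_simp
    obtain ⟨t, ht⟩ : R * Q ∣ N ^ (2 * n + 1) := by
      have e : N ^ (2 * n + 1) = N ^ l * N ^ k * N ^ (n - k) * N ^ j * N ^ (n + 1 - l - j) := by
        simp only [← pow_add]; congr 1; omega
      rw [e, hR]
      refine Dvd.dvd.mul_right ?_ _
      refine Nat.mul_dvd_mul (Nat.mul_dvd_mul (Nat.mul_dvd_mul hl ?_) dvd_rfl) hj
      exact hk ▸ Dvd.intro_left _ rfl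
    rw [floorSeq_eq hN x hR0 hRn,
      floorSeq_eq hN x (R := N * R) (by positivity)
        (by push_cast; rw [pow_succ, ← hRn]; ring),
      ← Nat.div_div_eq_div_mul, centralVal_succ, mul_comm _ N, Nat.mul_add_div hN,
      Nat.div_eq_of_lt (x _).2, add_zero, ht,
      show (x (-(n + 1 : ℕ)) : ℕ) * (R * Q * t) + centralVal x n
        = R * (Q * (t * x (-(n + 1 : ℕ)))) + centralVal x n by ring,
      Nat.mul_add_div hR0, Nat.mul_add_mod]

/-- The residue modulo `Q` of the integral part of `α` times the number represented by `x`, for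
`α` and `Q` with all prime factors among those of the base. -/
noncomputable def digitAt {N : ℕ} (x : Config N) (α : ℚ) (Q : ℕ) : ℕ :=
  Classical.epsilon fun a => ∀ᶠ n in atTop, floorSeq x α n % Q = a

theorem exists_digitAt_eq {N : ℕ} (hN : 0 < N) {α : ℚ} (hα : IsScale N α) {Q : ℕ}
    (hQ : IsSmooth N Q) :
    ∃ n₀, ∀ (x : Config N) (n : ℕ), n₀ ≤ n → digitAt x α Q = floorSeq x α n % Q := by
  obtain ⟨n₀, h⟩ := floorSeq_stable hN hα hQ
  refine ⟨n₀, fun x n hn => ?_⟩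
  have h1 : ∀ᶠ n in atTop, floorSeq x α n % Q = digitAt x α Q :=
    Classical.epsilon_spec (p := fun a => ∀ᶠ n in atTop, floorSeq x α n % Q = a)
      ⟨floorSeq x α n₀ % Q, eventually_atTop.2 ⟨n₀, h x⟩⟩
  obtain ⟨m, hm, hm'⟩ := (h1.and (eventually_ge_atTop n₀)).exists
  rw [← hm, h x n hn, h x m hm']

theorem eventually_digitAt_eq {N : ℕ} (hN : 0 < N) (x : Config N) {α : ℚ} (hα : IsScale N α)
    {Q : ℕ} (hQ : IsSmooth N Q) : ∀ᶠ n in atTop, digitAt x α Q = floorSeq x α n % Q := by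
  obtain ⟨n₀, h⟩ := exists_digitAt_eq hN hα hQ
  exact eventually_atTop.2 ⟨n₀, h x⟩

/-! ### Digit families and their uniqueness -/

/-- The functions `(α, Q) ↦ ⌊α ξ⌋ mod Q` for `ξ` a number with digits in base `N`. The notion
depends only on the prime factors of `N`. -/
structure IsDigitFamily (N : ℕ) (D : ℚ → ℕ → ℕ) : Prop where
  mod_eq : ∀ {α : ℚ} {Q R : ℕ}, IsScale N α → IsSmooth N Q → IsSmooth N R →
    D α (Q * R) % Q = D α Q
  div_eq : ∀ {α : ℚ} {Q R : ℕ}, IsScale N α → IsSmooth N Q → IsSmooth N R →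
    D α (Q * R) / R = D (α / R) Q

theorem isDigitFamily_digitAt {N : ℕ} (hN : 0 < N) (x : Config N) :
    IsDigitFamily N (digitAt x) where
  mod_eq {α Q R} hα hQ hR := by
    obtain ⟨n, h1, h2⟩ :=
      ((eventually_digitAt_eq hN x hα (hQ.mul hR)).and (eventually_digitAt_eq hN x hα hQ)).exists
    rw [h1, h2, Nat.mod_mul_right_mod]
  div_eq {α Q R} hα hQ hR := by
    obtain ⟨n, h1, h2⟩ := ((eventually_digitAt_eq hN x hα (hQ.mul hR)).and
      (eventually_digitAt_eq hN x (hα.div hR.isScale) hQ)).exists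
    rw [h1, h2, floorSeq_div, mul_comm, Nat.mod_mul_right_div_self]

theorem IsDigitFamily.of_isSmooth {N M : ℕ} {D : ℚ → ℕ → ℕ} (h : IsDigitFamily N D)
    (hM : IsSmooth N M) : IsDigitFamily M D where
  mod_eq hα hQ hR := h.mod_eq (hα.trans hM) (hM.trans hQ) (hM.trans hR)
  div_eq hα hQ hR := h.div_eq (hα.trans hM) (hM.trans hQ) (hM.trans hR)

theorem IsDigitFamily.rescale {N : ℕ} {D : ℚ → ℕ → ℕ} (h : IsDigitFamily N D) {β : ℚ}
    (hβ : IsScale N β) : IsDigitFamily N fun α Q => D (β * α) Q where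
  mod_eq hα hQ hR := h.mod_eq (hβ.mul hα) hQ hR
  div_eq hα hQ hR := by rw [h.div_eq (hβ.mul hα) hQ hR, mul_div_assoc]

/-- Division with remainder by `R`: `div_eq` gives the quotient and `mod_eq` the remainder. -/
theorem IsDigitFamily.add_eq {N : ℕ} {D : ℚ → ℕ → ℕ} (h : IsDigitFamily N D) {α : ℚ}
    (hα : IsScale N α) {Q R : ℕ} (hQ : IsSmooth N Q) (hR : IsSmooth N R) :
    D α (Q * R) = R * D (α / R) Q + D α R := by
  rw [← h.div_eq hα hQ hR, ← h.mod_eq hα hR hQ, mul_comm R Q, Nat.div_add_mod]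

/-- Horner's scheme: `add_eq` with `R = N` splits off one digit at a time. -/
theorem IsDigitFamily.eq_wordVal {N : ℕ} (hN : 0 < N) {D : ℚ → ℕ → ℕ} (h : IsDigitFamily N D)
    {x : Config N} (hx : ∀ i : ℤ, D ((N : ℚ) ^ i) N = x i) (i : ℤ) (k : ℕ) :
    D ((N : ℚ) ^ (i + k)) (N ^ (k + 1)) = wordVal x i k := by
  have hs := IsSmooth.self N
  induction k with
  | zero => simpa [wordVal] using hx i
  | succ k ih =>
    rw [pow_succ, h.add_eq (hs.isScale_zpow _) (hs.pow _) hs, hx, wordVal, ← ih,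
      show i + ((k + 1 : ℕ) : ℤ) = i + k + 1 by push_cast; ring,
      zpow_add_one₀ (by positivity), mul_div_cancel_right₀ _ (by positivity), mul_comm]

/-- If `Q` divides N^(k+1), then `mod_eq` obtains D(N^l, Q) from the value of a word of `x`. A
general scale is a/b = N^k / (a' b) with a a' = N^k, and `div_eq` obtains D(a/b, Q) from D(N^k, Q a'
b). -/
theorem IsDigitFamily.ext {N : ℕ} (hN : 0 < N) {D D' : ℚ → ℕ → ℕ} (h : IsDigitFamily N D)
    (h' : IsDigitFamily N D') {x : Config N} (hx : ∀ i : ℤ, D ((N : ℚ) ^ i) N = x i)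
    (hx' : ∀ i : ℤ, D' ((N : ℚ) ^ i) N = x i) {α : ℚ} (hα : IsScale N α) {Q : ℕ}
    (hQ : IsSmooth N Q) : D α Q = D' α Q := by
  have hs := IsSmooth.self N
  have hN' : (N : ℚ) ≠ 0 := by positivity
  have h1 : ∀ (l : ℕ) {Q : ℕ}, IsSmooth N Q → D ((N : ℚ) ^ l) Q = D' ((N : ℚ) ^ l) Q := by
    intro l Q hQ
    obtain ⟨k, t, ht⟩ := hQ.imp fun k hk => hk.trans (pow_dvd_pow N (Nat.le_succ k))
    have hQ' : IsSmooth N Q := (hs.pow (k + 1)).of_dvd ⟨t, ht⟩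
    have ht' : IsSmooth N t := (hs.pow (k + 1)).of_dvd ⟨Q, by rw [ht, mul_comm]⟩
    -- The word ends at position `l` and has `k + 1` letters, so it starts at `l - k`, which may be
    -- negative.
    have e : ((N : ℚ) ^ l) = (N : ℚ) ^ ((l : ℤ) - k + k) := by simp
    have hl : IsScale N ((N : ℚ) ^ ((l : ℤ) - k + k)) := hs.isScale_zpow _
    rw [e, ← h.mod_eq hl hQ' ht', ← h'.mod_eq hl hQ' ht', ← ht, h.eq_wordVal hN hx,
      h'.eq_wordVal hN hx']
  obtain ⟨a, b, ⟨k, a', hk⟩, hb, rfl⟩ := hα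
  have ha' : IsSmooth N a' := (hs.pow k).of_dvd ⟨a, by rw [hk, mul_comm]⟩
  have hb0 := hb.pos hN
  have ha0 := ha'.pos hN
  have e : (a : ℚ) / b = (N : ℚ) ^ k / ((a' * b : ℕ) : ℚ) := by
    rw [← Nat.cast_pow, hk]
    push_cast
    have : (a' : ℚ) ≠ 0 := by positivity
    have : (b : ℚ) ≠ 0 := by positivity
    field_simp
  have hk' : IsScale N ((N : ℚ) ^ k) := by simpa using (hs.pow k).isScale
  rw [e, ← h.div_eq hk' hQ (ha'.mul hb), ← h'.div_eq hk' hQ (ha'.mul hb),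
    h1 k (hQ.mul (ha'.mul hb))]

theorem digitAt_zpow {N : ℕ} (hN : 0 < N) (x : Config N) (i : ℤ) :
    digitAt x ((N : ℚ) ^ i) N = x i := by
  have hs := IsSmooth.self N
  obtain ⟨n, h1, h2⟩ := ((eventually_digitAt_eq hN x (hs.isScale_zpow i) hs).and
    (eventually_ge_atTop i.natAbs)).exists
  -- In `x[-n] ⋯ x[n]`, `m` digits precede position `i` and `l` follow it; division by N^l cuts off
  -- the latter.
  obtain ⟨l, hl⟩ : ∃ l : ℕ, (n : ℤ) - i = l := ⟨((n : ℤ) - i).toNat, by omega⟩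
  obtain ⟨m, hm⟩ : ∃ m : ℕ, (n : ℤ) + i = m := ⟨((n : ℤ) + i).toNat, by omega⟩
  have hN' : (N : ℚ) ≠ 0 := by positivity
  rw [h1, floorSeq_eq hN x (R := N ^ l) (by positivity)
      (by push_cast; rw [← zpow_natCast, ← zpow_natCast, ← zpow_add₀ hN']; congr 1; omega),
    centralVal, show 2 * n = m + l by omega, wordVal_add_div hN, wordVal_mod]
  congr 2
  omega

/-- The working form of uniqueness: to identify the whole family of a configuration, it is enough to
compare single digits at the powers of one base. -/
theorem IsDigitFamily.digitAt_eq {N : ℕ} (hN : 0 < N) {D : ℚ → ℕ → ℕ} (h : IsDigitFamily N D)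
    {x : Config N} (hx : ∀ i : ℤ, D ((N : ℚ) ^ i) N = x i) {α : ℚ} (hα : IsScale N α) {Q : ℕ}
    (hQ : IsSmooth N Q) : digitAt x α Q = D α Q :=
  (isDigitFamily_digitAt hN x).ext hN h (digitAt_zpow hN x) hx hα hQ

theorem Config.ext_digitAt {N : ℕ} (hN : 0 < N) {x y : Config N}
    (h : ∀ i : ℤ, digitAt x ((N : ℚ) ^ i) N = digitAt y ((N : ℚ) ^ i) N) : x = y := by
  funext i
  apply Fin.ext
  rw [← digitAt_zpow hN, ← digitAt_zpow hN, h]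

theorem digitAt_lt {N : ℕ} (hN : 0 < N) (x : Config N) {α : ℚ} (hα : IsScale N α)
    {Q : ℕ} (hQ : IsSmooth N Q) : digitAt x α Q < Q := by
  obtain ⟨n, h⟩ := (eventually_digitAt_eq hN x hα hQ).exists
  rw [h]
  exact Nat.mod_lt _ (hQ.pos hN)

/-- By the uniform bound in `exists_digitAt_eq`, the value depends on one central word of fixed
length. -/
theorem continuous_digitAt {N : ℕ} (hN : 0 < N) {α : ℚ} (hα : IsScale N α)
    {Q : ℕ} (hQ : IsSmooth N Q) : Continuous fun x : Config N => digitAt x α Q := by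
  obtain ⟨n, h⟩ := exists_digitAt_eq hN hα hQ
  have hw : ∀ (i : ℤ) (k : ℕ), Continuous fun x : Config N => wordVal x i k := by
    intro i k
    have hc : ∀ j : ℤ, Continuous fun x : Config N => (x j : ℕ) := fun j =>
      (continuous_of_discreteTopology (f := fun a : Fin N => (a : ℕ))).comp (continuous_apply j)
    induction k with
    | zero => exact hc i
    | succ k ih => exact (ih.mul continuous_const).add (hc _)
  simp_rw [fun x => h x n le_rfl]
  exact (continuous_of_discreteTopology
    (f := fun w : ℕ => ⌊α * ((w : ℚ) / (N : ℚ) ^ n)⌋₊ % Q)).comp (hw (-n) (2 * n))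

theorem digitAt_recast {N M : ℕ} (h : N = M) (x : Config N) (α : ℚ) (Q : ℕ) :
    digitAt (x.recast h) α Q = digitAt x α Q := by
  subst h
  rfl

/-! ### Multiplication automata -/

/-- By uniqueness only D(p N^i, N) has to be computed. With q = N / p it equals p D(N^i, q) + D(p
N^i, p). The first term contains x[i] mod q; since p N^i = N^(i+1) / q, the second is the quotient
of x[i+1] by q. This is the local rule. -/
theorem digitAt_mulPerm {N : ℕ} (hN : 0 < N) (p : N.divisors) (x : Config N) {α : ℚ}
    (hα : IsScale N α) {Q : ℕ} (hQ : IsSmooth N Q) :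
    digitAt (mulPerm p x) α Q = digitAt x ((p : ℕ) * α) Q := by
  obtain ⟨hp, hq, hpq, hd⟩ := divisor_facts p
  have hs := IsSmooth.self N
  have hp' : IsSmooth N p := hs.of_dvd hd
  have hq' : IsSmooth N (N / p) := hs.of_dvd (Nat.div_dvd_of_dvd hd)
  have hD := isDigitFamily_digitAt hN x
  have hp0 : ((p : ℕ) : ℚ) ≠ 0 := by positivity
  have hq0 : ((N / p : ℕ) : ℚ) ≠ 0 := by exact_mod_cast hq.ne'
  refine (hD.rescale hp'.isScale).digitAt_eq hN (fun i => ?_) hα hQ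
  have hi : IsScale N ((p : ℕ) * (N : ℚ) ^ i) := hp'.isScale.mul (hs.isScale_zpow i)
  have e1 := hD.add_eq hi hq' hp'
  rw [mul_comm (N / (p : ℕ)), hpq, mul_div_cancel_left₀ _ hp0,
    ← hD.mod_eq (hs.isScale_zpow i) hq' hp', mul_comm (N / (p : ℕ)), hpq, digitAt_zpow hN] at e1
  have e2 := hD.div_eq (hs.isScale_zpow (i + 1)) hp' hq'
  rw [hpq, digitAt_zpow hN, show (N : ℚ) ^ (i + 1) / ((N / p : ℕ) : ℚ) = (p : ℕ) * (N : ℚ) ^ i by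
    rw [div_eq_iff hq0, zpow_add_one₀ (by positivity)]
    have : ((p : ℕ) : ℚ) * ((N / p : ℕ) : ℚ) = N := by exact_mod_cast hpq
    linear_combination -(N : ℚ) ^ i * this] at e2
  rw [e1, ← e2]
  simp [mulPerm, mulDiv, mulLocal, mul_comm]

theorem isSmooth_listProd {N : ℕ} (ps : List N.divisors) : IsSmooth N (listProd ps) :=
  ⟨_, listProd_dvd ps⟩

theorem digitAt_listPerm {N : ℕ} (hN : 0 < N) (ps : List N.divisors) (x : Config N) {α : ℚ}
    (hα : IsScale N α) {Q : ℕ} (hQ : IsSmooth N Q) :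
    digitAt (listPerm ps x) α Q = digitAt x (listProd ps * α) Q := by
  induction ps generalizing α with
  | nil => simp [listPerm, listProd]
  | cons p ps ih =>
    have hp' : IsSmooth N p := (IsSmooth.self N).of_dvd (divisor_facts p).2.2.2
    have e1 : listPerm (p :: ps) x = mulPerm p (listPerm ps x) := by simp [listPerm]
    have e2 : listProd (p :: ps) = p * listProd ps := by simp [listProd]
    rw [e1, e2, digitAt_mulPerm hN p _ hα hQ, ih (hp'.isScale.mul hα)]
    congr 1
    push_cast
    ring

theorem MulDefined.exists_isScale {N : ℕ} {α : ℝ} (h : MulDefined N α) :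
    ∃ β : ℚ, IsScale N β ∧ (β : ℝ) = α := by
  obtain ⟨ps, qs, h⟩ := h
  refine ⟨listProd ps / listProd qs, (isSmooth_listProd ps).isScale.div
    (isSmooth_listProd qs).isScale, ?_⟩
  rw [IsFactorization] at h
  rw [h]
  push_cast
  rfl

theorem digitAt_mulCA {N : ℕ} (hN : 0 < N) {α : ℝ} (h : MulDefined N α) {β : ℚ}
    (hβ : (β : ℝ) = α) (x : Config N) {γ : ℚ} (hγ : IsScale N γ) {Q : ℕ} (hQ : IsSmooth N Q) :
    digitAt (mulCA N α h x) γ Q = digitAt x (β * γ) Q := by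
  obtain ⟨ps, qs, hf⟩ := id h
  have hp := isSmooth_listProd ps
  have hq := isSmooth_listProd qs
  have hq0 : (listProd qs : ℚ) ≠ 0 := by exact_mod_cast (listProd_pos qs).ne'
  have hβ' : β = listProd ps / listProd qs := by
    rw [IsFactorization, ← hβ] at hf
    apply Rat.cast_injective (α := ℝ)
    rw [hf]
    push_cast
    rfl
  have hs : IsScale N (listProd ps * γ) := hp.isScale.mul hγ
  -- Expressing `x` through its preimage turns the inverse automaton into a forward one, so no
  -- separate formula for inverses is needed.
  have e : x = listPerm qs ((listPerm qs)⁻¹ x) := by simp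
  rw [mulCA_eq h hf, Equiv.Perm.mul_apply, digitAt_listPerm hN ps _ hγ hQ]
  have hβs : IsScale N β := hβ' ▸ hp.isScale.div hq.isScale
  conv_rhs => rw [e, digitAt_listPerm hN qs _ (hβs.mul hγ) hQ]
  congr 1
  rw [hβ']
  field_simp

theorem mulCA_apply {N : ℕ} (hN : 0 < N) {α : ℝ} (h : MulDefined N α) {β : ℚ}
    (hβ : (β : ℝ) = α) (x : Config N) (i : ℤ) :
    (mulCA N α h x i : ℕ) = digitAt x (β * (N : ℚ) ^ i) N := by
  have hs := IsSmooth.self N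
  rw [← digitAt_zpow hN, digitAt_mulCA hN h hβ x (hs.isScale_zpow i) hs]

theorem Config.continuous_of_digitAt {N M : ℕ} (hN : 0 < N) (hM : IsSmooth N M)
    {ψ : Config N → Config M} {α : ℤ → ℚ} (hα : ∀ i, IsScale N (α i))
    (h : ∀ x i, (ψ x i : ℕ) = digitAt x (α i) M) : Continuous ψ := by
  refine continuous_pi fun i => ?_
  have hc : Continuous fun x => (ψ x i : ℕ) := by
    simp_rw [h]
    exact continuous_digitAt hN (hα i) hM
  rw [continuous_discrete_rng]
  intro b
  convert hc.isOpen_preimage {(b : ℕ)} (isOpen_discrete _) using 1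
  ext x
  simp [Fin.ext_iff]

theorem isDynSystem_mulCA {N : ℕ} (hN : 0 < N) {α : ℝ} (h : MulDefined N α) :
    IsDynSystem (mulCA N α h) where
  compact := inferInstance
  metrizable := inferInstance
  continuous := by
    obtain ⟨β, hβ, e⟩ := h.exists_isScale
    have hs := IsSmooth.self N
    exact Config.continuous_of_digitAt hN hs (fun i => hβ.mul (hs.isScale_zpow i))
      (mulCA_apply hN h e)

/-! ### The represented number -/

theorem wordVal_eq_sum {N : ℕ} (hN : 0 < N) (x : Config N) (i : ℤ) (k : ℕ) :
    (wordVal x i k : ℝ≥0∞) = (N : ℝ≥0∞) ^ (i + k) *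
      ∑ j ∈ Finset.Icc (-(i + k)) (-i), ((x (-j) : ℕ) : ℝ≥0∞) * (N : ℝ≥0∞) ^ j := by
  have hN0 : (N : ℝ≥0∞) ≠ 0 := by exact_mod_cast hN.ne'
  have hNt : (N : ℝ≥0∞) ≠ ⊤ := ENNReal.natCast_ne_top N
  induction k with
  | zero =>
    simp only [wordVal, Nat.cast_zero, add_zero, Finset.Icc_self, Finset.sum_singleton, neg_neg]
    rw [mul_left_comm, ← ENNReal.zpow_add hN0 hNt]
    simp
  | succ k ih =>
    have e : Finset.Icc (-(i + (k + 1 : ℕ))) (-i)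
        = insert (-(i + (k + 1 : ℕ))) (Finset.Icc (-(i + k)) (-i)) := by
      ext j; simp only [Finset.mem_Icc, Finset.mem_insert]; omega
    rw [e, Finset.sum_insert (by simp), mul_add, wordVal]
    push_cast
    rw [ih, add_comm]
    congr 1
    · rw [neg_neg, mul_left_comm, ← ENNReal.zpow_add hN0 hNt, add_neg_cancel, zpow_zero, mul_one]
    · rw [← add_assoc i, ENNReal.zpow_add hN0 hNt _ 1, zpow_one]
      ring

theorem centralVal_eq {N : ℕ} (hN : 0 < N) (x : Config N) (n : ℕ) :
    (centralVal x n : ℝ≥0∞) = (N : ℝ≥0∞) ^ n *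
      ∑ j ∈ Finset.Icc (-n : ℤ) n, ((x (-j) : ℕ) : ℝ≥0∞) * (N : ℝ≥0∞) ^ j := by
  rw [centralVal, wordVal_eq_sum hN, show (-n : ℤ) + (2 * n : ℕ) = n by push_cast; ring,
    zpow_natCast, neg_neg]

/-- A truncation is at most the full sum, and taking the floor and the residue can only decrease the
value. -/
theorem digitAt_le_realOf {N : ℕ} (hN : 0 < N) (x : Config N) {R : ℕ}
    (hR : IsSmooth N R) {Q : ℕ} (hQ : IsSmooth N Q) :
    (digitAt x (R : ℚ) Q : ℝ≥0∞) ≤ R * realOf N x := by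
  obtain ⟨n, h⟩ := (eventually_digitAt_eq hN x hR.isScale hQ).exists
  have hN0 : (N : ℝ≥0∞) ^ n ≠ 0 := by exact_mod_cast (pow_pos hN n).ne'
  have hNt : (N : ℝ≥0∞) ^ n ≠ ⊤ := ENNReal.pow_ne_top (ENNReal.natCast_ne_top N)
  have h1 : digitAt x (R : ℚ) Q * N ^ n ≤ R * centralVal x n := by
    have h2 : ((digitAt x (R : ℚ) Q : ℕ) : ℚ) ≤ R * ((centralVal x n : ℚ) / (N : ℚ) ^ n) := by
      rw [h]
      exact (Nat.cast_le.2 (Nat.mod_le _ _)).trans (Nat.floor_le (by positivity))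
    rw [← mul_div_assoc, le_div_iff₀ (by positivity)] at h2
    exact_mod_cast h2
  have h3 : (digitAt x (R : ℚ) Q : ℝ≥0∞) * (N : ℝ≥0∞) ^ n ≤ R * centralVal x n := by
    exact_mod_cast h1
  rw [← ENNReal.mul_le_mul_iff_left hN0 hNt]
  refine h3.trans ?_
  rw [centralVal_eq hN, mul_left_comm, mul_comm]
  gcongr
  exact ENNReal.sum_le_tsum _

/-- The partial sum over |j| ≤ n, multiplied by N^n, is the central value D(N^n, N^(2n+1)) of `x`.
It is also a value of the family of `y`, hence at most N^n times the number represented by `y`. -/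
theorem realOf_le {N M : ℕ} (hN : 0 < N) (hM : 0 < M) (hMN : IsSmooth M N)
    (x : Config N) (y : Config M)
    (h : ∀ {α Q}, IsScale N α → IsSmooth N Q → digitAt x α Q = digitAt y α Q) :
    realOf N x ≤ realOf M y := by
  have hs := IsSmooth.self N
  rw [realOf, ENNReal.tsum_eq_iSup_sum]
  refine iSup_le fun s => ?_
  obtain ⟨n, hn⟩ : ∃ n : ℕ, s ⊆ Finset.Icc (-n : ℤ) n := by
    refine ⟨∑ i ∈ s, i.natAbs, fun i hi => ?_⟩
    have := Finset.single_le_sum (f := fun i : ℤ => i.natAbs) (fun _ _ => Nat.zero_le _) hi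
    rw [Finset.mem_Icc]
    omega
  refine (Finset.sum_le_sum_of_subset hn).trans ?_
  have hN0 : (N : ℝ≥0∞) ^ n ≠ 0 := by exact_mod_cast (pow_pos hN n).ne'
  have hNt : (N : ℝ≥0∞) ^ n ≠ ⊤ := ENNReal.pow_ne_top (ENNReal.natCast_ne_top N)
  rw [← ENNReal.mul_le_mul_iff_right hN0 hNt, ← centralVal_eq hN]
  have e := (isDigitFamily_digitAt hN x).eq_wordVal hN (digitAt_zpow hN x) (-n) (2 * n)
  rw [show (-n : ℤ) + (2 * n : ℕ) = n by push_cast; ring, zpow_natCast, ← Nat.cast_pow,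
    h (hs.pow n).isScale (hs.pow _)] at e
  rw [centralVal, ← e]
  simpa using digitAt_le_realOf hM y (hMN.pow n) (hMN.pow (2 * n + 1))

/-! ### Tessellations and microtiles -/

/-! ### Multiplicativity of weights -/

section Weights

variable {d : ℕ} (n : Fin d → ℕ+)

theorem wgt_pos (z : Fin d → ℤ) : 0 < wgt n z :=
  Finset.prod_pos fun j _ => zpow_pos (by exact_mod_cast (n j).pos) _

theorem wgt_add (z w : Fin d → ℤ) : wgt n (z + w) = wgt n z * wgt n w := by
  unfold wgt
  rw [← Finset.prod_mul_distrib]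
  refine Finset.prod_congr rfl fun j _ => ?_
  rw [← zpow_add₀ (by exact_mod_cast (n j).ne_zero)]
  congr 1
  simp only [Pi.add_apply]
  ring

theorem wgt_sub (z w : Fin d → ℤ) : wgt n (z - w) = wgt n z / wgt n w := by
  rw [eq_div_iff (wgt_pos n w).ne', ← wgt_add, sub_add_cancel]

theorem wgt_stdVec (i : Fin d) : wgt n (stdVec i) = ((n i : ℕ) : ℚ)⁻¹ := by
  unfold wgt
  rw [Finset.prod_eq_single i]
  · simp [stdVec]
  · intro j _ hj
    simp [stdVec, hj]
  · simp

theorem natWgt_add {v w : Fin d → ℤ} (hv : v ≤ 0) (hw : w ≤ 0) :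
    natWgt n (v + w) = natWgt n v * natWgt n w := by
  have h : (natWgt n (v + w) : ℚ) = natWgt n v * natWgt n w := by
    rw [natWgt_eq_wgt n hv, natWgt_eq_wgt n hw, natWgt_eq_wgt n (add_nonpos hv hw), wgt_add]
  exact_mod_cast h

theorem natWgt_neg_one : natWgt n (-1) = baseProd n := by
  simp [natWgt, baseProd]

theorem wgt_const_inv (i : ℤ) : (wgt n fun _ => i)⁻¹ = (baseProd n : ℚ) ^ i := by
  simp [wgt, baseProd, Finset.prod_zpow]

theorem isSmooth_coord (i : Fin d) : IsSmooth (baseProd n) (n i) :=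
  (IsSmooth.self _).of_dvd (Finset.dvd_prod_of_mem (fun i => (n i : ℕ)) (Finset.mem_univ i))

theorem isScale_wgt {N : ℕ} (h : ∀ i, IsSmooth N (n i)) (z : Fin d → ℤ) : IsScale N (wgt n z) :=
  IsScale.prod _ _ fun i _ => (h i).isScale_zpow _

theorem cast_wgt_inv (z : Fin d → ℤ) : (((wgt n z)⁻¹ : ℚ) : ℝ) = vecScale n z := by
  simp [wgt, vecScale]

end Weights

/-- The cube at `z` has value D(α(z), N) with α(z) = 1 / wgt(z), and its edge in direction `e_i`
retains the residue mod `n i`. -/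
theorem tess_edge {d : ℕ} (n : Fin d → ℕ+) (x : Config (baseProd n)) (z : Fin d → ℤ)
    (i : Fin d) :
    (((tess n x).1 z).1 (Face.edge i) : ℕ) = digitAt x (wgt n z)⁻¹ (n i) := by
  obtain ⟨e0, -, e2, -⟩ := natWgt_face n i
  have hN := baseProd_pos n
  obtain ⟨t, ht⟩ := Finset.dvd_prod_of_mem (fun i => (n i : ℕ)) (Finset.mem_univ i)
  change baseProd n = n i * t at ht
  have ht' : IsSmooth (baseProd n) t := (IsSmooth.self _).of_dvd ⟨n i, by rw [ht, mul_comm]⟩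
  simp only [tess, tessFun, cube, cubeFun, Face.edge, vecDigit, midDigit, e0, e2, Nat.div_one]
  rw [mulCA_apply hN _ (cast_wgt_inv n z), zpow_zero, mul_one,
    ← (isDigitFamily_digitAt hN x).mod_eq (isScale_wgt n (isSmooth_coord n) z).inv
      (isSmooth_coord n i) ht', ← ht]

/-- With u = wgt(z), the remainder of ⌊ξ/u⌋ mod `n i` is ⌊ξ/u⌋ - n_i ⌊ξ/(u n_i)⌋, so the edge
integral is a difference of the potential wgt(z) ⌊ξ / wgt(z)⌋. The potential may diverge with the
truncation; its differences stabilize. -/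
theorem eventually_edgeIntegral_tess {d : ℕ} (n : Fin d → ℕ+) (x : Config (baseProd n))
    (i : Fin d) (z : Fin d → ℤ) :
    ∀ᶠ k in atTop, edgeIntegral (tess n x) i z = wgt n z * floorSeq x (wgt n z)⁻¹ k
      - wgt n (z - stdVec i) * floorSeq x (wgt n (z - stdVec i))⁻¹ k := by
  filter_upwards [eventually_digitAt_eq (baseProd_pos n) x
    (isScale_wgt n (isSmooth_coord n) z).inv (isSmooth_coord n i)] with k hk
  have e : wgt n (z - stdVec i) = wgt n z * (n i : ℕ) := by
    rw [wgt_sub, wgt_stdVec, div_inv_eq_mul]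
  rw [edgeIntegral, tess_edge, hk, e, mul_inv, ← div_eq_mul_inv, floorSeq_div, mul_assoc, ← mul_sub]
  congr 1
  rw [eq_sub_iff_add_eq]
  exact_mod_cast Nat.mod_add_div _ _

/-- The potential telescopes. Only the end points survive, so the arbitrary path chosen in
`integralFrom` is harmless. -/
theorem eventually_integral_tess {d : ℕ} (n : Fin d → ℕ+) (x : Config (baseProd n))
    {p q : Fin d → ℤ} (P : GridPath p q) :
    ∀ᶠ k in atTop, P.integral (tess n x) = wgt n q * floorSeq x (wgt n q)⁻¹ k
      - wgt n p * floorSeq x (wgt n p)⁻¹ k := by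
  induction P with
  | nil => simp [GridPath.integral]
  | fwd P i ih =>
    filter_upwards [ih, eventually_edgeIntegral_tess n x i _] with k h1 h2
    rw [GridPath.integral, h1, h2, add_sub_cancel_right]
    ring
  | bwd P i ih =>
    filter_upwards [ih, eventually_edgeIntegral_tess n x i _] with k h1 h2
    rw [GridPath.integral, h1, h2]
    ring

/-- Divided by `wgt n q`, the potential difference is F - K ⌊F/K⌋ with K = `natWgt n (p - q)`, the
remainder of F mod K. The label is thus a natural number and its floor loses nothing. -/
theorem eventually_floor_label_tess {d : ℕ} (n : Fin d → ℕ+) (x : Config (baseProd n))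
    {p q : Fin d → ℤ} (h : p ≤ q) :
    ∀ᶠ k in atTop, ⌊label (tess n x) p q⌋₊ = floorSeq x (wgt n q)⁻¹ k % natWgt n (p - q) := by
  filter_upwards [eventually_integral_tess n x
    (Classical.choice (GridPath.exists_path p q))] with k hk
  have hq := (wgt_pos n q).ne'
  have e : wgt n p = wgt n q * natWgt n (p - q) := by
    rw [natWgt_eq_wgt n (sub_nonpos.2 h), wgt_sub, mul_div_cancel₀ _ hq]
  rw [label, integralFrom, hk, e, mul_inv, ← div_eq_mul_inv, floorSeq_div, mul_assoc, ← mul_sub,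
    mul_div_cancel_left₀ _ hq, ← Nat.floor_natCast (R := ℚ) (_ % _)]
  congr 1
  rw [sub_eq_iff_eq_add]
  exact_mod_cast (Nat.mod_add_div _ _).symm

/-! ### Microtiles as digits -/

theorem wgt_powMat {d d' : ℕ} (n : Fin d → ℕ+) (A : Matrix (Fin d) (Fin d') ℕ)
    (z : Fin d' → ℤ) : wgt (powMat n A) z = wgt n (matVec A z) := by
  have h0 : ∀ j, ((n j : ℕ) : ℚ) ≠ 0 := fun j => by exact_mod_cast (n j).ne_zero
  have e : ∀ j, ((n j : ℕ) : ℚ) ^ (-matVec A z j)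
      = ∏ i, (((n j : ℕ) : ℚ) ^ A j i) ^ (-z i) := fun j => by
    simp only [matVec, Matrix.mulVec, dotProduct, Matrix.map_apply, ← zpow_natCast, ← zpow_mul]
    rw [← Finset.sum_neg_distrib]
    simp only [← mul_neg]
    induction (Finset.univ : Finset (Fin d')) using Finset.induction_on with
    | empty => simp
    | insert i s hi ih => rw [Finset.sum_insert hi, Finset.prod_insert hi, zpow_add₀ (h0 j), ih]
  unfold wgt
  simp only [e]
  rw [Finset.prod_comm]
  refine Finset.prod_congr rfl fun i _ => ?_
  rw [Finset.prod_zpow]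
  simp [powMat]

/-- A positive entry in row `i` makes `n i` divide a coordinate of `n ^ A`, so the scales of the
finer grid are admissible for `x`. -/
theorem isSmooth_powMat {d d' : ℕ} (n : Fin d → ℕ+) (A : Matrix (Fin d) (Fin d') ℕ)
    (hA : ∀ i, ∃ j, 0 < A i j) (i : Fin d) : IsSmooth (baseProd (powMat n A)) (n i) := by
  obtain ⟨j, hj⟩ := hA i
  refine (isSmooth_coord (powMat n A) j).of_dvd ((dvd_pow_self _ hj.ne').trans ?_)
  have e : (powMat n A j : ℕ) = ∏ i, (n i : ℕ) ^ A i j :=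
    map_prod PNat.coeMonoidHom (fun i => n i ^ A i j) Finset.univ
  rw [e]
  exact Finset.dvd_prod_of_mem (fun i => (n i : ℕ) ^ A i j) (Finset.mem_univ i)

theorem isSmooth_baseProd_powMat {d d' : ℕ} (n : Fin d → ℕ+) (A : Matrix (Fin d) (Fin d') ℕ)
    (hA : ∀ i, ∃ j, 0 < A i j) : IsSmooth (baseProd (powMat n A)) (baseProd n) :=
  IsSmooth.prod _ _ fun i _ => isSmooth_powMat n A hA i

/-- The label of the bracket is ⌊ξ / wgt(A z₁)⌋ modulo a multiple of natWgt(-v) ∏ n_i, so this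
reduction does not affect the digit at (-v, -v-1). Division by natWgt(-v) moves the scale from A z₁
to `w`, and the chosen bracket drops out. -/
theorem micro_tess_val {d d' : ℕ} (n : Fin d → ℕ+) (A : Matrix (Fin d) (Fin d') ℕ)
    (hA : ∀ i, ∃ j, 0 < A i j) (x : Config (baseProd (powMat n A))) (w : Fin d → ℤ) :
    ((micro n A hA (tess (powMat n A) x) w).val : ℕ) = digitAt x (wgt n w)⁻¹ (baseProd n) := by
  rw [micro, Cube.val_cube]
  obtain ⟨h1, h2, h3⟩ := (exists_bracket A hA w).choose_spec
  change vecDigit n ⌊label (tess (powMat n A) x) _ _⌋₊ (-(matVec A _ - w))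
    (-(matVec A _ - w) - 1) = _
  generalize (exists_bracket A hA w).choose = z at *
  obtain ⟨k, hk, hk'⟩ := ((eventually_floor_label_tess (powMat n A) x h2).and
    (eventually_digitAt_eq (baseProd_pos _) x (isScale_wgt n (isSmooth_powMat n A hA) w).inv
      (isSmooth_baseProd_powMat n A hA))).exists
  obtain ⟨v, hv⟩ : ∃ v, v = matVec A z.1 - w := ⟨_, rfl⟩
  have hv0 : -v ≤ 0 := by rw [hv]; simpa using h1
  have hn : (-1 : Fin d → ℤ) ≤ 0 := fun _ => by simp
  have hmv : matVec A (z.2 - z.1) = matVec A z.2 - matVec A z.1 := Matrix.mulVec_sub _ _ _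
  -- The bracket condition A z₂ ≤ w - 1. Natural weights truncate exponents at zero, so they
  -- multiply only when every summand is nonpositive.
  have hr : matVec A (z.2 - z.1) + v + 1 ≤ 0 := by
    rw [hmv, hv]
    intro i
    have := h3 i
    simp only [Pi.sub_apply, Pi.add_apply, Pi.one_apply, Pi.zero_apply] at this ⊢
    omega
  have e1 : natWgt n (-v - 1) = natWgt n (-v) * baseProd n := by
    rw [sub_eq_add_neg, natWgt_add n hv0 hn, natWgt_neg_one]
  have e2 : natWgt (powMat n A) (z.2 - z.1)
      = natWgt n (-v) * (baseProd n * natWgt n (matVec A (z.2 - z.1) + v + 1)) := by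
    rw [← natWgt_neg_one, ← natWgt_add n hn hr, ← natWgt_add n hv0 (add_nonpos hn hr)]
    have e : -v + (-1 + (matVec A (z.2 - z.1) + v + 1)) = matVec A (z.2 - z.1) := by abel
    have h4 : matVec A (z.2 - z.1) ≤ 0 := e ▸ add_nonpos hv0 (add_nonpos hn hr)
    rw [e]
    have : (natWgt (powMat n A) (z.2 - z.1) : ℚ) = natWgt n (matVec A (z.2 - z.1)) := by
      rw [natWgt_eq_wgt _ (sub_nonpos.2 h2), natWgt_eq_wgt _ h4, wgt_powMat]
    exact_mod_cast this
  have e3 : (wgt n w)⁻¹ = (wgt (powMat n A) z.1)⁻¹ / natWgt n (-v) := by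
    rw [natWgt_eq_wgt n hv0, wgt_powMat, div_eq_mul_inv, ← mul_inv, ← wgt_add]
    congr 2
    rw [hv]
    abel
  rw [← hv, vecDigit, midDigit, hk, hk', e1, e2, e3, floorSeq_div,
    Nat.mul_div_cancel_left _ (natWgt_pos n _), Nat.mod_mul_right_div_self, Nat.mod_mul_right_mod]

/-! ### The conjugacy -/

theorem isSmooth_primeProd {N : ℕ} : IsSmooth N (primeProd N) :=
  IsSmooth.prod _ _ fun _ hp => (IsSmooth.self N).of_dvd (Nat.dvd_of_mem_primeFactors hp)

theorem isSmooth_of_primeProd {N : ℕ} (hN : N ≠ 0) : IsSmooth (primeProd N) N := by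
  conv => arg 2; rw [← Nat.prod_factorization_pow_eq_self hN]
  exact IsSmooth.prod _ _ fun p hp =>
    ((IsSmooth.self _).of_dvd (Finset.dvd_prod_of_mem (fun p => p) hp)).pow _

theorem primeProd_pos (N : ℕ) : 0 < primeProd N :=
  Finset.prod_pos fun _ hp => (Nat.prime_of_mem_primeFactors hp).pos

/-- On the diagonal w = (i, …, i), the inverse weight is M^i. -/
theorem conjToPrimes_apply {N : ℕ} (hN : 1 < N) (x : Config N) (i : ℤ) :
    (conjToPrimes N hN x i : ℕ) = digitAt x ((primeProd N : ℚ) ^ i) (primeProd N) := by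
  simp only [conjToPrimes, Config.recast, Fin.val_cast, diag]
  have h := micro_tess_val (primeVec N) (expMat N) (expMat_row N)
    (x.recast (baseProd_powMat hN)) fun _ => i
  rw [wgt_const_inv, digitAt_recast] at h
  rw [← baseProd_primeVec]
  exact h

/-- The family of `x` is also a digit family for base `M`, and its base-`M` digits are those of the
image; uniqueness in base `M` applies. -/
theorem digitAt_conjToPrimes {N : ℕ} (hN : 1 < N) (x : Config N) {α : ℚ} (hα : IsScale N α)
    {Q : ℕ} (hQ : IsSmooth N Q) : digitAt (conjToPrimes N hN x) α Q = digitAt x α Q :=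
  have hs := isSmooth_of_primeProd (N := N) (by omega)
  ((isDigitFamily_digitAt (by omega) x).of_isSmooth isSmooth_primeProd).digitAt_eq (primeProd_pos N)
    (fun i => (conjToPrimes_apply hN x i).symm) (hα.trans hs) (hs.trans hQ)

theorem conjToPrimes_bijective {N : ℕ} (hN : 1 < N) :
    Function.Bijective (conjToPrimes N hN) := by
  have hN0 : 0 < N := by omega
  have hs := IsSmooth.self N
  refine ⟨fun x y h => Config.ext_digitAt hN0 fun i => ?_, fun y => ?_⟩
  · rw [← digitAt_conjToPrimes hN x (hs.isScale_zpow i) hs, h,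
      digitAt_conjToPrimes hN y (hs.isScale_zpow i) hs]
  · have hp := isSmooth_of_primeProd hN0.ne'
    have hm := isSmooth_primeProd (N := N)
    have hD := (isDigitFamily_digitAt (primeProd_pos N) y).of_isSmooth hp
    -- The preimage consists of the base-`N` digits of the family of `y`.
    let x : Config N := fun i => ⟨digitAt y ((N : ℚ) ^ i) N,
      digitAt_lt (primeProd_pos N) y (hp.isScale_zpow i) hp⟩
    refine ⟨x, Config.ext_digitAt (primeProd_pos N) fun i => ?_⟩
    rw [digitAt_conjToPrimes hN x (hm.isScale_zpow i) hm]
    exact hD.digitAt_eq hN0 (fun i => rfl) (hm.isScale_zpow i) hm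

section ConjMap

variable {N N' : ℕ} (hN : 1 < N) (hN' : 1 < N') (h : N.primeFactors = N'.primeFactors)

/-- Surjectivity of `conjToPrimes` makes `invFun` a right inverse, so both configurations have the
same image in base `M`, and each shares its family with that image. -/
theorem digitAt_conjMap (x : Config N) {α : ℚ} (hα : IsScale N α) {Q : ℕ} (hQ : IsSmooth N Q) :
    digitAt (conjMap N N' hN hN' h x) α Q = digitAt x α Q := by
  have hs : IsSmooth N' N := isSmooth_of_primeFactors_subset (by omega) h.le
  have : Nonempty (Config N') := ⟨fun _ => ⟨0, by omega⟩⟩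
  have e : conjToPrimes N' hN' (conjMap N N' hN hN' h x)
      = (conjToPrimes N hN x).recast (by rw [primeProd, primeProd, h]) :=
    Function.invFun_eq ((conjToPrimes_bijective hN').surjective _)
  rw [← digitAt_conjToPrimes hN' _ (hα.trans hs) (hs.trans hQ), e, digitAt_recast,
    digitAt_conjToPrimes hN x hα hQ]

theorem conjMap_apply (x : Config N) (i : ℤ) :
    (conjMap N N' hN hN' h x i : ℕ) = digitAt x ((N' : ℚ) ^ i) N' := by
  have hs : IsSmooth N N' := isSmooth_of_primeFactors_subset (by omega) h.ge
  rw [← digitAt_conjMap hN hN' h x (hs.isScale_zpow i) hs, digitAt_zpow (by omega)]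

theorem conjMap_leftInverse :
    Function.LeftInverse (conjMap N' N hN' hN h.symm) (conjMap N N' hN hN' h) := fun x => by
  have hs := IsSmooth.self N
  have hs' : IsSmooth N' N := isSmooth_of_primeFactors_subset (by omega) h.le
  refine Config.ext_digitAt (by omega) fun i => ?_
  rw [digitAt_conjMap hN' hN h.symm _ (hs'.isScale_zpow i) hs',
    digitAt_conjMap hN hN' h x (hs.isScale_zpow i) hs]

theorem isConjugacy_conjMap {α : ℝ} (hα : MulDefined N α) (hα' : MulDefined N' α) :
    IsConjugacy (mulCA N α hα) (mulCA N' α hα') (conjMap N N' hN hN' h) where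
  source := isDynSystem_mulCA (by omega) hα
  target := isDynSystem_mulCA (by omega) hα'
  continuous :=
    have hs : IsSmooth N N' := isSmooth_of_primeFactors_subset (by omega) h.ge
    Config.continuous_of_digitAt (by omega) hs hs.isScale_zpow (conjMap_apply hN hN' h)
  bijective := Function.bijective_iff_has_inverse.2
    ⟨_, conjMap_leftInverse hN hN' h, conjMap_leftInverse hN' hN h.symm⟩
  equivariant := by
    -- With D the family of `x`, both sides have digits D(β N'^i, N'): either automaton rescales by
    -- β, and the conjugacy preserves families.
    obtain ⟨β, hβ, e⟩ := hα.exists_isScale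
    have hs : IsSmooth N N' := isSmooth_of_primeFactors_subset (by omega) h.ge
    have hs' := IsSmooth.self N'
    funext x
    refine Config.ext_digitAt (by omega) fun i => ?_
    have hi := hs.isScale_zpow i
    simp only [Function.comp_apply]
    rw [digitAt_conjMap hN hN' h _ hi hs, digitAt_mulCA (by omega) hα e x hi hs,
      digitAt_mulCA (by omega) hα' e _ (hs'.isScale_zpow i) hs',
      digitAt_conjMap hN hN' h _ (hβ.mul hi) hs]

theorem realOf_conjMap (x : Config N) : realOf N' (conjMap N N' hN hN' h x) = realOf N x := by
  have hs : IsSmooth N N' := isSmooth_of_primeFactors_subset (by omega) h.ge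
  have hs' : IsSmooth N' N := isSmooth_of_primeFactors_subset (by omega) h.le
  apply le_antisymm
  · exact realOf_le (by omega) (by omega) hs _ _ fun hα hQ =>
      digitAt_conjMap hN hN' h x (hα.trans hs) (hs.trans hQ)
  · exact realOf_le (by omega) (by omega) hs' _ _ fun hα hQ =>
      (digitAt_conjMap hN hN' h x hα hQ).symm

end ConjMap

theorem mainTheorem1 (N₁ N₂ : ℕ) (hN₁ : 1 < N₁) (hN₂ : 1 < N₂)
    (h : N₁.primeFactors = N₂.primeFactors) :
    Function.Bijective (conjToPrimes N₂ hN₂) ∧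
    (∀ α : ℝ, 0 < α → ∀ (h₁ : MulDefined N₁ α) (h₂ : MulDefined N₂ α),
      IsConjugacy (mulCA N₁ α h₁) (mulCA N₂ α h₂) (conjMap N₁ N₂ hN₁ hN₂ h)) ∧
    realOf N₂ ∘ conjMap N₁ N₂ hN₁ hN₂ h = realOf N₁ :=
  ⟨conjToPrimes_bijective hN₂, fun _ _ h₁ h₂ => isConjugacy_conjMap hN₁ hN₂ h h₁ h₂,
    funext fun x => realOf_conjMap hN₁ hN₂ h x⟩
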